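/- Let $m\ge 3$ be an integer. By an $m$-gon $\mathcal M$ we mean a simple closed polygonal curve in the Euclidean plane $\mathbb R^2$ with $m$ vertices (not necessarily convex), joined cyclically by $m$ straight edges; simple means that the closed curve does not pass through any point twice. Let $\mathsf A(\mathcal M)$ denote the area of the region enclosed by $\mathcal M$ (the curve together with the bounded part of its complement), and let $\mathsf S(\mathcal M)$ denote half the perimeter of $\mathcal M$. Call $\mathcal M$ a unit $m$-gon if $\mathsf A(\mathcal M)=\mathsf S(\mathcal M)$. The fundamental measure $\Pi_{\mathcal M}$ of a unit $m$-gon $\mathcal M$ is the area of its rescaling by the factor $\mathsf S(\mathcal M)/\mathsf A(\mathcal M)=1$, that is, $\Pi_{\mathcal M}=\mathsf A(\mathcal M)=\mathsf S(\mathcal M)$. Put $\rho_m:=m\tan(\pi/m)$, and let $\mathcal U^{(m\text{-reg})}$ be a regular $m$-gon with unit apothem, i.e. the distance from its center to each side equals $1$. Then every unit $m$-gon $\mathcal M$ satisfies $$\rho_m\le \Pi_{\mathcal M},$$ with equality if and only if $\mathcal M$ is congruent to $\mathcal U^{(m\text{-reg})}$, i.e. some isometry of the plane maps $\mathcal M$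 onto $\mathcal U^{(m\text{-reg})}$. -/

import Mathlib

noncomputable section

namespace UnitShapes

/-- The Euclidean plane. -/
abbrev Plane : Type := EuclideanSpace ℝ (Fin 2)

/-- The region enclosed by a curve (identified with its image `C`): the points of `C`, together
with the points of the complement that lie in a bounded connected component of it. -/
def enclosedRegion (C : Set Plane) : Set Plane :=
  C ∪ {x ∈ Cᶜ | Bornology.IsBounded (connectedComponentIn Cᶜ x)}

/-- The area of the enclosed region (Lebesgue measure). -/
def area (C : Set Plane) : ℝ :=
  MeasureTheory.volume.real (enclosedRegion C)

/-- Two plane curves are congruent if a rigid motion (a Euclidean isometry, possibly reversing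
the orientation) maps the image of the first onto the image of the second. -/
def AreCongruent (C D : Set Plane) : Prop :=
  ∃ f : Plane ≃ᵃⁱ[ℝ] Plane, f '' C = D

variable {m : ℕ}

/-- The closed polygonal line through the vertices of `M` is a simple closed curve: run through
edge by edge, with each edge parametrized by `[0, 1)`, it visits no point twice. In particular
consecutive vertices are distinct. Straight angles at vertices are allowed. -/
def IsSimple (M : Polygon Plane m) : Prop :=
  ∀ i j : Fin m, ∀ s ∈ Set.Ico (0 : ℝ) 1, ∀ t ∈ Set.Ico (0 : ℝ) 1,
    M.edgePath ℝ i s = M.edgePath ℝ j t → i = j ∧ s = t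

/-- The area enclosed by a polygon. -/
def polyArea (M : Polygon Plane m) : ℝ := area (M.boundary ℝ)

/-- The perimeter of a polygon: the sum of its side lengths. -/
def perimeter (M : Polygon Plane m) : ℝ :=
  ∑ i : Fin m, dist (M i) (M (finRotate m i))

/-- Half of the perimeter. -/
def semiperimeter (M : Polygon Plane m) : ℝ := perimeter M / 2

/-- A unit polygon: its area equals its semiperimeter. -/
def IsUnitPolygon (M : Polygon Plane m) : Prop :=
  polyArea M = semiperimeter M

/-- The image of a polygon under the scaling `x ↦ c • x` of the plane. -/
def scale (c : ℝ) (M : Polygon Plane m) : Polygon Plane m := ⟨fun i => c • M i⟩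

/-- The canonical unit polygon similar to `M`: `M` scaled by semiperimeter over area. -/
def canonicalUnit (M : Polygon Plane m) : Polygon Plane m :=
  scale (semiperimeter M / polyArea M) M

/-- The fundamental measure: the area of the canonical unit polygon similar to `M`. -/
def fundamentalMeasure (M : Polygon Plane m) : ℝ := polyArea (canonicalUnit M)

/-- The constant `m tan(π / m)`. -/
def rho (m : ℕ) : ℝ := m * Real.tan (Real.pi / m)

/-- The regular `m`-gon centred at the origin with unit apothem, that is, with circumradius
`1 / cos(π / m)`. -/
def regularPolygon (m : ℕ) : Polygon Plane m :=
  ⟨fun k => (1 / Real.cos (Real.pi / m)) •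
    !₂[Real.cos (2 * Real.pi * (k : ℕ) / m), Real.sin (2 * Real.pi * (k : ℕ) / m)]⟩

end UnitShapes

end

noncomputable section

namespace UnitShapes

section

open Finset ComplexConjugate

/-! ### The discrete Wirtinger inequality -/

/-! The theorem follows from an isoperimetric inequality for $m$-gons, `4 * rho m * A ≤ L ^ 2`, with
$A$ the area and $L$ the perimeter: a unit polygon has $L = 2A$, so dividing by $4A$ leaves $\rho_m
\le A$.

The enclosed region lies in the convex hull of the vertices, so it suffices to bound the area of
that hull (`volume_convexHull_le`). This avoids all topology of simple curves. The hull is compared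
with the signed area of another closed polygon (`exists_volume_convexHull_le`): redundant vertices
are dropped and the rest are put in the order of a shortest tour. Uncrossing two edges shortens a
tour, so each edge of a shortest one has all vertices on one side. Hence the triangles spanned by
its edges with an interior point cover the hull, and their areas add up to the signed area.

For signed areas (`signedArea_le`), compactness provides a polygon maximizing area against squared
length. If the maximum is positive, the maximizer is equilateral, since otherwise moving one vertex
would improve it. For an equilateral polygon $L^2$ is $m$ times the sum of the squared sides, and
the discrete Wirtinger inequality, read off from the Fourier coefficients of the vertices, gives the
constant $m\tan(\pi/m)$.

In the equality case only the frequencies 0 and 1 survive, so the comparison polygon is regular. Its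
vertices are those of the original one in some order; since the lengths agree, every original edge
is a shortest chord, that is, a side of the regular polygon (`exists_regular_of_volume_eq`). -/

/-- The cross product of two plane vectors, written as complex numbers. -/
def cross (a b : ℂ) : ℝ := a.re * b.im - a.im * b.re

/-- The signed area of the closed polygon with vertices `w k`. -/
def signedArea {m : ℕ} [NeZero m] (w : ZMod m → ℂ) : ℝ := (∑ k, cross (w k) (w (k + 1))) / 2

/-- The length of the closed polygon with vertices `w k`. -/
def closedLength {m : ℕ} [NeZero m] (w : ZMod m → ℂ) : ℝ := ∑ k, dist (w k) (w (k + 1))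

theorem cross_eq_im (a b : ℂ) : cross a b = (conj a * b).im := by
  simp [cross]; ring

section Wirtinger

variable {m : ℕ} [NeZero m]

open ZMod

/-- Parseval's identity, from Fourier inversion; the transform is not normalized, whence the factor
`m`. -/
theorem sum_conj_dft_mul_dft (u v : ZMod m → ℂ) :
    ∑ j, conj (dft u j) * dft v j = m * ∑ k, conj (u k) * v k := by
  have hinv : ∀ k, ∑ j, stdAddChar (j * k) * dft v j = m * v k := by
    intro k
    have h := congrFun (dft.symm_apply_apply v) k
    rw [invDFT_apply] at h
    rw [← h, smul_eq_mul, ← mul_assoc, mul_inv_cancel₀ (by exact_mod_cast NeZero.ne m), one_mul]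
    simp
  calc ∑ j, conj (dft u j) * dft v j
      = ∑ j, ∑ k, conj (u k) * (stdAddChar (j * k) * dft v j) := by
        refine sum_congr rfl fun j _ => ?_
        rw [dft_apply, map_sum, sum_mul]
        refine sum_congr rfl fun k _ => ?_
        rw [smul_eq_mul, map_mul, AddChar.map_neg_eq_conj, Complex.conj_conj, mul_comm k j]
        ring
    _ = m * ∑ k, conj (u k) * v k := by
        rw [sum_comm, mul_sum]
        refine sum_congr rfl fun k _ => ?_
        rw [← mul_sum, hinv]
        ring

theorem dft_comp_add_one (z : ZMod m → ℂ) (j : ZMod m) :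
    dft (fun k => z (k + 1)) j = stdAddChar j * dft z j := by
  rw [dft_apply, dft_apply, mul_sum]
  rw [← Equiv.sum_comp (Equiv.addRight (1 : ZMod m))
    (fun k => stdAddChar j * (stdAddChar (-(k * j)) • z k))]
  refine sum_congr rfl fun k _ => ?_
  simp only [Equiv.coe_addRight, smul_eq_mul]
  rw [← mul_assoc, ← AddChar.map_add_eq_mul]
  congr 2
  ring

theorem stdAddChar_re_im (j : ZMod m) :
    (stdAddChar j : ℂ).re = Real.cos (2 * (Real.pi * j.val / m)) ∧
      (stdAddChar j : ℂ).im = Real.sin (2 * (Real.pi * j.val / m)) := by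
  have h : (stdAddChar j : ℂ) = Complex.exp ((2 * (Real.pi * j.val / m) : ℝ) * Complex.I) := by
    rw [stdAddChar_apply, toCircle_apply]
    congr 1
    push_cast
    ring
  rw [h, Complex.exp_ofReal_mul_I_re, Complex.exp_ofReal_mul_I_im]
  exact ⟨rfl, rfl⟩

/-- The sum of squared sides and the signed area are quadratic forms invariant under cyclic shifts,
so the Fourier basis diagonalizes both, with eigenvalues $|\omega^j-1|^2$ and (for the sum of cross
products) $\operatorname{Im}\omega^j$. -/
theorem wirtinger_sum (z : ZMod m → ℂ) :
    m * (∑ k, dist (z k) (z (k + 1)) ^ 2 - 4 * Real.tan (Real.pi / m) * signedArea z) =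
      ∑ j, ‖dft z j‖ ^ 2 * (Complex.normSq (stdAddChar j - 1) -
        2 * Real.tan (Real.pi / m) * (stdAddChar j : ℂ).im) := by
  have h1 := sum_conj_dft_mul_dft (fun k => z (k + 1) - z k) (fun k => z (k + 1) - z k)
  have h2 := sum_conj_dft_mul_dft z (fun k => z (k + 1))
  have hd : ∀ j, dft (fun k => z (k + 1) - z k) j = (stdAddChar j - 1) * dft z j := by
    intro j
    have : dft (fun k => z (k + 1) - z k) = dft (fun k => z (k + 1)) - dft z := by
      rw [← map_sub]; rfl
    rw [this, Pi.sub_apply, dft_comp_add_one]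
    ring
  have e1 : (m : ℝ) * ∑ k, dist (z k) (z (k + 1)) ^ 2 =
      ∑ j, ‖dft z j‖ ^ 2 * Complex.normSq (stdAddChar j - 1) := by
    have := congrArg Complex.re h1
    rw [Complex.re_sum, ← Complex.ofReal_natCast, Complex.re_ofReal_mul, Complex.re_sum] at this
    rw [eq_comm]
    convert this using 1
    · refine sum_congr rfl fun j _ => ?_
      rw [hd, ← Complex.normSq_eq_conj_mul_self, Complex.ofReal_re, Complex.normSq_mul,
        Complex.normSq_eq_norm_sq (dft z j)]
      ring
    · congr 1
      refine sum_congr rfl fun k _ => ?_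
      rw [← Complex.normSq_eq_conj_mul_self, Complex.ofReal_re, dist_comm, dist_eq_norm,
        Complex.normSq_eq_norm_sq]
  have e2 : (m : ℝ) * ∑ k, cross (z k) (z (k + 1)) =
      ∑ j, ‖dft z j‖ ^ 2 * (stdAddChar j : ℂ).im := by
    have := congrArg Complex.im h2
    rw [Complex.im_sum, ← Complex.ofReal_natCast, Complex.im_ofReal_mul, Complex.im_sum] at this
    rw [eq_comm]
    convert this using 1
    · refine sum_congr rfl fun j _ => ?_
      rw [dft_comp_add_one, mul_left_comm, ← Complex.normSq_eq_conj_mul_self, Complex.im_mul_ofReal,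
        Complex.normSq_eq_norm_sq (dft z j)]
      ring
    · congr 1
      refine sum_congr rfl fun k _ => ?_
      rw [cross_eq_im]
  have e3 : ∑ j, ‖dft z j‖ ^ 2 * (Complex.normSq (stdAddChar j - 1) -
        2 * Real.tan (Real.pi / m) * (stdAddChar j : ℂ).im) =
      ∑ j, ‖dft z j‖ ^ 2 * Complex.normSq (stdAddChar j - 1) - 2 * Real.tan (Real.pi / m) *
        ∑ j, ‖dft z j‖ ^ 2 * (stdAddChar j : ℂ).im := by
    rw [mul_sum, ← sum_sub_distrib]
    exact sum_congr rfl fun j _ => by ring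
  rw [e3, ← e1, ← e2, signedArea]
  ring

theorem pi_div_pos (m : ℕ) [NeZero m] : 0 < Real.pi / m :=
  div_pos Real.pi_pos (by exact_mod_cast Nat.pos_of_ne_zero (NeZero.ne m))

theorem pi_div_lt {m : ℕ} (hm : 3 ≤ m) : Real.pi / m < Real.pi / 2 :=
  div_lt_div_of_pos_left Real.pi_pos (by norm_num) (by exact_mod_cast hm)

theorem cos_pi_div_pos (hm : 3 ≤ m) : 0 < Real.cos (Real.pi / m) :=
  Real.cos_pos_of_mem_Ioo ⟨by linarith [pi_div_pos m, Real.pi_pos], pi_div_lt hm⟩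

theorem tan_pi_div_pos (hm : 3 ≤ m) : 0 < Real.tan (Real.pi / m) :=
  Real.tan_pos_of_pos_of_lt_pi_div_two (pi_div_pos m) (pi_div_lt hm)

/-- With $\theta=\pi j/m$, the two terms are $4\sin^2\theta$ and $4\tan(\pi/m)\sin\theta\cos\theta$;
the subtraction formula for the sine factors the difference. The product vanishes for $j=0,1$, and
for $2\le j<m$ both angles lie in $(0,\pi)$. -/
theorem wirtinger_coeff (hm : 3 ≤ m) (j : ZMod m) :
    Complex.normSq (stdAddChar j - 1) - 2 * Real.tan (Real.pi / m) * (stdAddChar j : ℂ).im =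
      4 * Real.sin (Real.pi * j.val / m) * Real.sin (Real.pi * j.val / m - Real.pi / m) /
        Real.cos (Real.pi / m) := by
  have hc := (cos_pi_div_pos hm).ne'
  rw [Complex.normSq_apply, Complex.sub_re, Complex.sub_im, (stdAddChar_re_im j).1,
    (stdAddChar_re_im j).2, Real.sin_sub, Real.tan_eq_sin_div_cos, Real.cos_two_mul,
    Real.sin_two_mul, Complex.one_re, Complex.one_im]
  field_simp
  have := Real.sin_sq_add_cos_sq (Real.pi * j.val / m)
  set s := Real.sin (Real.pi * j.val / m)
  set c := Real.cos (Real.pi * j.val / m)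
  have hs : s ^ 2 = 1 - c ^ 2 := by linarith
  ring_nf
  rw [hs]
  ring

theorem wirtinger_coeff_pos (hm : 3 ≤ m) {j : ZMod m} (h0 : j ≠ 0) (h1 : j ≠ 1) :
    0 < Complex.normSq (stdAddChar j - 1) -
      2 * Real.tan (Real.pi / m) * (stdAddChar j : ℂ).im := by
  rw [wirtinger_coeff hm]
  have hmpos : (0 : ℝ) < m := by exact_mod_cast (by omega : 0 < m)
  have hlt : (j.val : ℝ) < m := by exact_mod_cast ZMod.val_lt j
  have hj : (2 : ℝ) ≤ j.val := by
    have h0' : j.val ≠ 0 := by rwa [Ne, ZMod.val_eq_zero]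
    have h1' : j.val ≠ 1 := fun h => h1 <| by
      rw [← ZMod.natCast_zmod_val j, h, Nat.cast_one]
    exact_mod_cast (by omega : 2 ≤ j.val)
  have hpi := Real.pi_pos
  have e : Real.pi * j.val / m - Real.pi / m = Real.pi * (j.val - 1) / m := by ring
  have s1 : 0 < Real.sin (Real.pi * j.val / m) := by
    apply Real.sin_pos_of_pos_of_lt_pi
    · positivity
    · rw [div_lt_iff₀ hmpos]; nlinarith
  have s2 : 0 < Real.sin (Real.pi * j.val / m - Real.pi / m) := by
    rw [e]
    apply Real.sin_pos_of_pos_of_lt_pi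
    · have : (0 : ℝ) < j.val - 1 := by linarith
      positivity
    · rw [div_lt_iff₀ hmpos]; nlinarith
  have := cos_pi_div_pos hm
  positivity

theorem wirtinger_coeff_nonneg (hm : 3 ≤ m) (j : ZMod m) :
    0 ≤ Complex.normSq (stdAddChar j - 1) -
      2 * Real.tan (Real.pi / m) * (stdAddChar j : ℂ).im := by
  by_cases h0 : j = 0
  · simp [h0]
  by_cases h1 : j = 1
  · have : Fact (1 < m) := ⟨by omega⟩
    rw [wirtinger_coeff hm, h1, ZMod.val_one]
    simp
  · exact (wirtinger_coeff_pos hm h0 h1).le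

/-- The discrete Wirtinger inequality. -/
theorem signedArea_le_sum_sq (hm : 3 ≤ m) (z : ZMod m → ℂ) :
    4 * Real.tan (Real.pi / m) * signedArea z ≤ ∑ k, dist (z k) (z (k + 1)) ^ 2 := by
  have hmpos : (0 : ℝ) < m := by exact_mod_cast (by omega : 0 < m)
  have h := wirtinger_sum z
  have : 0 ≤ (m : ℝ) *
      (∑ k, dist (z k) (z (k + 1)) ^ 2 - 4 * Real.tan (Real.pi / m) * signedArea z) := by
    rw [h]
    exact sum_nonneg fun j _ => mul_nonneg (by positivity) (wirtinger_coeff_nonneg hm j)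
  linarith [nonneg_of_mul_nonneg_right this hmpos]

/-- Equality in the discrete Wirtinger inequality holds only for regular polygons. -/
theorem exists_regular_of_wirtinger_eq (hm : 3 ≤ m) (z : ZMod m → ℂ)
    (h : 4 * Real.tan (Real.pi / m) * signedArea z = ∑ k, dist (z k) (z (k + 1)) ^ 2) :
    ∃ c b : ℂ, ∀ k, z k = c + b * stdAddChar k := by
  have hz : ∀ j, j ≠ 0 → j ≠ 1 → dft z j = 0 := by
    intro j h0 h1
    have hs := wirtinger_sum z
    rw [h, sub_self, mul_zero, eq_comm, sum_eq_zero_iff_of_nonneg fun j _ =>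
      mul_nonneg (by positivity) (wirtinger_coeff_nonneg hm j)] at hs
    have := hs j (mem_univ _)
    rcases mul_eq_zero.1 this with h' | h'
    · simpa using h'
    · exact absurd h' (wirtinger_coeff_pos hm h0 h1).ne'
  refine ⟨(m : ℂ)⁻¹ * dft z 0, (m : ℂ)⁻¹ * dft z 1, fun k => ?_⟩
  have hk := congrFun (dft.symm_apply_apply z) k
  have : Fact (1 < m) := ⟨by omega⟩
  rw [invDFT_apply, ← sum_subset (subset_univ {(0 : ZMod m), 1}), sum_pair zero_ne_one] at hk
  · rw [← hk]
    simp
    ring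
  · intro j _ hj
    simp only [mem_insert, mem_singleton, not_or] at hj
    rw [hz j hj.1 hj.2, smul_zero]

end Wirtinger

end

section

open Finset ComplexConjugate

/-! ### The isoperimetric inequality for the signed area of closed polygons -/

theorem cross_self (a : ℂ) : cross a a = 0 := by simp [cross]; ring

theorem cross_sub_sub (a b c : ℂ) :
    cross (b - a) (c - a) = cross a b + cross b c + cross c a := by
  simp only [cross, Complex.sub_re, Complex.sub_im]; ring

section Isoperimetric

variable {m : ℕ} [NeZero m]

theorem closedLength_nonneg (w : ZMod m → ℂ) : 0 ≤ closedLength w :=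
  sum_nonneg fun _ _ => dist_nonneg

theorem dist_le_closedLength (w : ZMod m → ℂ) (k : ZMod m) :
    dist (w k) (w (k + 1)) ≤ closedLength w :=
  single_le_sum (f := fun k => dist (w k) (w (k + 1))) (fun _ _ => dist_nonneg) (mem_univ k)

theorem signedArea_eq_zero_of_closedLength_eq_zero {w : ZMod m → ℂ} (h : closedLength w = 0) :
    signedArea w = 0 := by
  have : ∀ k, cross (w k) (w (k + 1)) = 0 := fun k => by
    have h1 := dist_le_closedLength w k
    rw [h] at h1
    rw [← dist_le_zero.1 h1, cross_self]
  simp [signedArea, this]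

theorem signedArea_affine (w : ZMod m → ℂ) (r : ℝ) (c : ℂ) :
    signedArea (fun k => (r : ℂ) * (w k - c)) = r ^ 2 * signedArea w := by
  have hs : ∑ k, w (k + 1) = ∑ k, w k := Equiv.sum_comp (Equiv.addRight (1 : ZMod m)) w
  have hre : ∑ k, (w (k + 1)).re = ∑ k, (w k).re := by simpa using congrArg Complex.re hs
  have him : ∑ k, (w (k + 1)).im = ∑ k, (w k).im := by simpa using congrArg Complex.im hs
  have : ∀ k, cross ((r : ℂ) * (w k - c)) ((r : ℂ) * (w (k + 1) - c)) =
      r ^ 2 * (cross (w k) (w (k + 1)) + c.im * ((w (k + 1)).re - (w k).re) -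
        c.re * ((w (k + 1)).im - (w k).im)) := by
    intro k
    simp [cross]
    ring
  simp only [signedArea, this, ← mul_sum, sum_sub_distrib, sum_add_distrib, hre, him]
  ring

theorem closedLength_affine (w : ZMod m → ℂ) (r : ℝ) (c : ℂ) :
    closedLength (fun k => (r : ℂ) * (w k - c)) = |r| * closedLength w := by
  simp only [closedLength, mul_sum]
  refine sum_congr rfl fun k _ => ?_
  rw [dist_eq_norm, dist_eq_norm, ← mul_sub, norm_mul, Complex.norm_real, Real.norm_eq_abs]
  congr 2
  ring

theorem sum_update (hm : 3 ≤ m) (f : ℂ → ℂ → ℝ) (w : ZMod m → ℂ) (k : ZMod m) (q : ℂ) :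
    ∑ j, f (Function.update w (k + 1) q j) (Function.update w (k + 1) q (j + 1)) =
      ∑ j, f (w j) (w (j + 1)) - f (w k) (w (k + 1)) - f (w (k + 1)) (w (k + 2)) +
        f (w k) q + f q (w (k + 2)) := by
  have : Fact (1 < m) := ⟨by omega⟩
  have h1 : k ≠ k + 1 := by simp
  have h2 : k + 2 ≠ k + 1 := fun h => by
    have : (1 : ZMod m) = 0 := by linear_combination h
    exact one_ne_zero this
  have e2 : k + 1 + 1 = k + 2 := by ring
  have key : ∑ j, (f (Function.update w (k + 1) q j) (Function.update w (k + 1) q (j + 1)) -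
      f (w j) (w (j + 1))) =
      (f (w k) q - f (w k) (w (k + 1))) + (f q (w (k + 2)) - f (w (k + 1)) (w (k + 2))) := by
    rw [← sum_subset (subset_univ {k, k + 1}), sum_pair h1, Function.update_self,
      Function.update_of_ne h1, e2, Function.update_of_ne h2]
    intro j _ hj
    simp only [mem_insert, mem_singleton, not_or] at hj
    rw [Function.update_of_ne hj.2, Function.update_of_ne (by simpa using hj.1), sub_self]
  rw [sum_sub_distrib] at key
  linarith

/-- Among points at a fixed nonzero height over a segment, the sum of distances to its ends is least
on the perpendicular bisector. Squaring the opposite inequality twice leaves $4x^2y^2\le 0$. -/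
theorem two_mul_norm_lt {ζ : ℂ} (hx : ζ.re ≠ 0) (hy : ζ.im ≠ 0) :
    2 * Real.sqrt (1 / 4 + ζ.im ^ 2) < ‖ζ + 1 / 2‖ + ‖ζ - 1 / 2‖ := by
  have ha : ‖ζ + 1 / 2‖ ^ 2 = (ζ.re + 1 / 2) ^ 2 + ζ.im ^ 2 := by
    rw [← Complex.normSq_eq_norm_sq, Complex.normSq_apply]; simp; ring
  have hb : ‖ζ - 1 / 2‖ ^ 2 = (ζ.re - 1 / 2) ^ 2 + ζ.im ^ 2 := by
    rw [← Complex.normSq_eq_norm_sq, Complex.normSq_apply]; simp; ring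
  have hg := Real.sq_sqrt (by positivity : (0 : ℝ) ≤ 1 / 4 + ζ.im ^ 2)
  have hg0 := Real.sqrt_nonneg (1 / 4 + ζ.im ^ 2)
  have ha0 := norm_nonneg (ζ + 1 / 2)
  have hb0 := norm_nonneg (ζ - 1 / 2)
  set a := ‖ζ + 1 / 2‖
  set b := ‖ζ - 1 / 2‖
  set g := Real.sqrt (1 / 4 + ζ.im ^ 2)
  set x := ζ.re
  set y := ζ.im
  by_contra! h
  have h1 : (a + b) ^ 2 ≤ (2 * g) ^ 2 := pow_le_pow_left₀ (by positivity) h 2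
  have h2 : a * b ≤ 1 / 4 + y ^ 2 - x ^ 2 := by nlinarith
  have h3 : (a * b) ^ 2 ≤ (1 / 4 + y ^ 2 - x ^ 2) ^ 2 := pow_le_pow_left₀ (by positivity) h2 2
  rw [mul_pow, ha, hb] at h3
  have h4 : 0 < x ^ 2 * y ^ 2 := by positivity
  nlinarith

/-- If the quotient of the signed area by the square of the length is maximal and positive, then
adjacent sides are equal. -/
theorem dist_eq_of_maximal (hm : 3 ≤ m) {A : ℝ} (hA : 0 < A)
    (hmax : ∀ v : ZMod m → ℂ, signedArea v ≤ A * closedLength v ^ 2) {w : ZMod m → ℂ}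
    (hw : signedArea w = A * closedLength w ^ 2) (k : ZMod m) :
    dist (w k) (w (k + 1)) = dist (w (k + 1)) (w (k + 2)) := by
  set p := w k with hp
  set q := w (k + 1) with hq
  set r := w (k + 2) with hr
  by_cases hD : r = p
  · rw [hD, dist_comm]
  have hD0 : r - p ≠ 0 := sub_ne_zero.2 hD
  set D := r - p with hDdef
  -- Coordinates in which `p` and `r` become `-1/2` and `1/2`.
  set ζ : ℂ := (q - (p + r) / 2) / D with hζ
  have hDpos : 0 < ‖D‖ := norm_pos_iff.2 hD0
  have hζD : D * ζ = q - (p + r) / 2 := by rw [hζ]; field_simp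
  have dpq : dist p q = ‖D‖ * ‖ζ + 1 / 2‖ := by
    rw [dist_comm, dist_eq_norm, ← norm_mul, mul_add, hζD]
    congr 1
    rw [hDdef]; ring
  have dqr : dist q r = ‖D‖ * ‖ζ - 1 / 2‖ := by
    rw [dist_eq_norm, ← norm_mul, mul_sub, hζD]
    congr 1
    rw [hDdef]; ring
  -- Maximality tested against the polygon whose vertex `q` is moved to the point `-t * I` of the
  -- perpendicular bisector.
  have hvar : ∀ t : ℝ, signedArea w + (t + ζ.im) * ‖D‖ ^ 2 / 2 ≤
      A * (closedLength w - dist p q - dist q r +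
        2 * (‖D‖ * Real.sqrt (1 / 4 + t ^ 2))) ^ 2 := by
    intro t
    set q' : ℂ := (p + r) / 2 + D * (-t * Complex.I) with hq'
    have hn : ∀ s : ℝ, s ^ 2 = 1 / 4 → ‖(s : ℂ) + t * Complex.I‖ = Real.sqrt (1 / 4 + t ^ 2) := by
      intro s hs
      rw [Complex.norm_add_mul_I, hs]
    have d1 : dist p q' = ‖D‖ * Real.sqrt (1 / 4 + t ^ 2) := by
      rw [← hn (-1 / 2) (by norm_num), ← norm_mul, dist_eq_norm]
      congr 1
      rw [hq', hDdef]; push_cast; ring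
    have d2 : dist q' r = ‖D‖ * Real.sqrt (1 / 4 + t ^ 2) := by
      rw [← hn (1 / 2) (by norm_num), ← norm_mul, dist_comm, dist_eq_norm]
      congr 1
      rw [hq', hDdef]; push_cast; ring
    have hL : closedLength (Function.update w (k + 1) q') = closedLength w - dist p q - dist q r +
        2 * (‖D‖ * Real.sqrt (1 / 4 + t ^ 2)) := by
      rw [closedLength, sum_update hm, d1, d2, closedLength]
      ring
    have hq2 : q = (p + r) / 2 + D * ζ := by rw [hζD]; ring
    have hS : signedArea (Function.update w (k + 1) q') =
        signedArea w + (t + ζ.im) * ‖D‖ ^ 2 / 2 := by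
      rw [signedArea, sum_update hm, signedArea, ← hp, ← hq, ← hr]
      have : cross p q' + cross q' r - cross p q - cross q r = (t + ζ.im) * ‖D‖ ^ 2 := by
        rw [hq2, hq', ← Complex.normSq_eq_norm_sq, Complex.normSq_apply, hDdef]
        simp [cross]
        ring
      linarith
    have := hmax (Function.update w (k + 1) q')
    rwa [hL, hS] at this
  have htri : ‖D‖ ≤ dist p q + dist q r := by
    rw [hDdef, ← dist_eq_norm, dist_comm]; exact dist_triangle _ _ _
  have hlen : dist p q + dist q r ≤ closedLength w := by
    have : Fact (1 < m) := ⟨by omega⟩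
    have h3 := sum_le_sum_of_subset_of_nonneg (subset_univ {k, k + 1})
      (f := fun j => dist (w j) (w (j + 1))) fun _ _ _ => dist_nonneg
    rwa [sum_pair (by simp), show k + 1 + 1 = k + 2 by ring] at h3
  -- If `q` is on the line `pr`, a displacement by `ε` gains area of order `ε` at a cost in length
  -- of order `ε ^ 2`. The bound on `ε` below turns the maximality inequality into `‖D‖ ≤ ‖D‖ / 2`.
  by_cases hy : ζ.im = 0
  · exfalso
    have hP := closedLength_nonneg w
    set P := closedLength w
    set ε : ℝ := min 1 (‖D‖ / (16 * A * (P + ‖D‖))) with hε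
    have hε0 : 0 < ε := lt_min one_pos (by positivity)
    have hε1 : ε ≤ 1 := min_le_left _ _
    have hε2 : ε * (16 * A * (P + ‖D‖)) ≤ ‖D‖ :=
      (le_div_iff₀ (by positivity)).1 (min_le_right _ _)
    have hs : Real.sqrt (1 / 4 + ε ^ 2) ≤ 1 / 2 + ε ^ 2 :=
      Real.sqrt_le_iff.2 ⟨by positivity, by nlinarith [sq_nonneg (ε ^ 2)]⟩
    have hs0 := Real.sqrt_nonneg (1 / 4 + ε ^ 2)
    have h1 := hvar ε
    have hU : (P - dist p q - dist q r + 2 * (‖D‖ * Real.sqrt (1 / 4 + ε ^ 2))) ≤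
        P + 2 * ‖D‖ * ε ^ 2 := by nlinarith
    have h2 : (P - dist p q - dist q r + 2 * (‖D‖ * Real.sqrt (1 / 4 + ε ^ 2))) ^ 2 ≤
        (P + 2 * ‖D‖ * ε ^ 2) ^ 2 :=
      pow_le_pow_left₀ (by have := mul_nonneg hDpos.le hs0; linarith) hU 2
    have h3 : signedArea w + (ε + ζ.im) * ‖D‖ ^ 2 / 2 ≤ A * (P + 2 * ‖D‖ * ε ^ 2) ^ 2 :=
      h1.trans (mul_le_mul_of_nonneg_left h2 hA.le)
    rw [hw, hy, add_zero] at h3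
    have h4 : ε * ‖D‖ * ‖D‖ ≤ ε * ‖D‖ * (A * (8 * P * ε + 8 * ‖D‖ * ε ^ 3)) := by nlinarith
    have h5 : ‖D‖ ≤ A * (8 * P * ε + 8 * ‖D‖ * ε ^ 3) := le_of_mul_le_mul_left h4 (by positivity)
    have h6 : ε ^ 3 ≤ ε := by
      calc ε ^ 3 = ε * (ε * ε) := by ring
        _ ≤ ε * (1 * 1) := by gcongr
        _ = ε := by ring
    have h7 : A * (8 * P * ε + 8 * ‖D‖ * ε ^ 3) ≤ A * (8 * P * ε + 8 * ‖D‖ * ε) := by gcongr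
    nlinarith
  by_cases hx : ζ.re = 0
  · rw [dpq, dqr]
    congr 1
    rw [← sq_eq_sq₀ (norm_nonneg _) (norm_nonneg _), ← Complex.normSq_eq_norm_sq,
      ← Complex.normSq_eq_norm_sq, Complex.normSq_apply, Complex.normSq_apply]
    simp [hx]
  · exfalso
    have hlt := two_mul_norm_lt hx hy
    -- Sliding `q` parallel to `pr` onto the bisector keeps the area and strictly shortens the
    -- polygon.
    have h1 := hvar (-ζ.im)
    rw [neg_add_cancel, zero_mul, zero_div, add_zero, neg_sq, hw] at h1
    have h2 := le_of_mul_le_mul_left h1 hA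
    have h3 := abs_le_of_sq_le_sq h2 (by
      have := mul_nonneg hDpos.le (Real.sqrt_nonneg (1 / 4 + ζ.im ^ 2)); linarith)
    have h4 := mul_lt_mul_of_pos_left hlt hDpos
    have h5 := le_abs_self (closedLength w)
    rw [dpq, dqr] at h3
    linarith

theorem dist_le_mul_closedLength (w : ZMod m → ℂ) (n : ℕ) :
    dist (w 0) (w n) ≤ n * closedLength w := by
  have h := dist_le_range_sum_dist (fun i : ℕ => w i) n
  rw [Nat.cast_zero] at h
  refine h.trans ?_
  rw [← nsmul_eq_mul]
  refine (sum_le_card_nsmul _ _ _ fun i _ => ?_).trans_eq (by rw [card_range])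
  rw [Nat.cast_succ]
  exact dist_le_closedLength w i

theorem continuous_signedArea : Continuous (signedArea : (ZMod m → ℂ) → ℝ) := by
  unfold signedArea cross
  fun_prop

theorem continuous_closedLength : Continuous (closedLength : (ZMod m → ℂ) → ℝ) := by
  unfold closedLength
  fun_prop

/-- Translating a vertex to 0 and rescaling to length at most 1 leaves a compact set. Polygons of
length zero cannot be rescaled, but have area zero. -/
theorem exists_maximal_signedArea :
    ∃ w : ZMod m → ℂ, closedLength w ≤ 1 ∧
      ∀ v : ZMod m → ℂ, signedArea v ≤ signedArea w * closedLength v ^ 2 := by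
  let K : Set (ZMod m → ℂ) := {w | w 0 = 0 ∧ closedLength w ≤ 1}
  have hclosed : IsClosed K :=
    (isClosed_eq (continuous_apply 0) continuous_const).inter
      (isClosed_le continuous_closedLength continuous_const)
  have hbdd : Bornology.IsBounded K := by
    refine (Metric.isBounded_closedBall (x := (0 : ZMod m → ℂ)) (r := m)).subset ?_
    rintro w ⟨h0, h1⟩
    rw [mem_closedBall_zero_iff, pi_norm_le_iff_of_nonneg (by positivity)]
    intro k
    have h := dist_le_mul_closedLength w k.val
    rw [h0, ZMod.natCast_zmod_val, dist_zero_left] at h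
    have hk : (k.val : ℝ) ≤ m := by exact_mod_cast (ZMod.val_lt k).le
    have := closedLength_nonneg w
    nlinarith
  have hne : K.Nonempty := ⟨0, rfl, by simp [closedLength]⟩
  obtain ⟨w, hwK, hw⟩ := (Metric.isCompact_of_isClosed_isBounded hclosed hbdd).exists_isMaxOn hne
    continuous_signedArea.continuousOn
  refine ⟨w, hwK.2, fun v => ?_⟩
  rcases (closedLength_nonneg v).eq_or_lt with h0 | hpos
  · rw [signedArea_eq_zero_of_closedLength_eq_zero h0.symm, ← h0]
    simp
  · have hv : (fun k => (((closedLength v)⁻¹ : ℝ) : ℂ) * (v k - v 0)) ∈ K := by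
      refine ⟨by simp, ?_⟩
      rw [closedLength_affine, abs_of_pos (inv_pos.2 hpos), inv_mul_cancel₀ hpos.ne']
    have h : signedArea _ ≤ signedArea w := hw hv
    rwa [signedArea_affine, inv_pow, inv_mul_le_iff₀ (by positivity), mul_comm] at h

theorem dist_eq_dist_zero {w : ZMod m → ℂ}
    (h : ∀ k, dist (w k) (w (k + 1)) = dist (w (k + 1)) (w (k + 2))) (k : ZMod m) :
    dist (w k) (w (k + 1)) = dist (w 0) (w 1) := by
  have : ∀ n : ℕ, dist (w n) (w (n + 1)) = dist (w 0) (w 1) := by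
    intro n
    induction n with
    | zero => simp
    | succ n ih =>
      rw [← ih, h n]
      push_cast
      congr 2
      ring
  have h := this k.val
  rwa [ZMod.natCast_zmod_val] at h

theorem sum_sq_eq_of_equilateral {w : ZMod m → ℂ}
    (h : ∀ k, dist (w k) (w (k + 1)) = dist (w (k + 1)) (w (k + 2))) :
    m * ∑ k, dist (w k) (w (k + 1)) ^ 2 = closedLength w ^ 2 := by
  simp only [closedLength, dist_eq_dist_zero h, sum_const, card_univ, ZMod.card, nsmul_eq_mul]
  ring

theorem rho_pos (hm : 3 ≤ m) : 0 < rho m :=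
  mul_pos (by exact_mod_cast (by omega : 0 < m)) (tan_pi_div_pos hm)

/-- The isoperimetric inequality for the signed area of closed polygons with `m` vertices. -/
theorem signedArea_le (hm : 3 ≤ m) (v : ZMod m → ℂ) :
    4 * rho m * signedArea v ≤ closedLength v ^ 2 := by
  obtain ⟨w, hw1, hw⟩ := exists_maximal_signedArea (m := m)
  have hρ := rho_pos hm
  rcases le_or_gt (signedArea w) 0 with hA | hA
  · have h1 := hw v
    have h2 : signedArea w * closedLength v ^ 2 ≤ 0 :=
      mul_nonpos_of_nonpos_of_nonneg hA (by positivity)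
    have h3 : 4 * rho m * signedArea v ≤ 0 :=
      mul_nonpos_of_nonneg_of_nonpos (by positivity) (h1.trans h2)
    exact h3.trans (by positivity)
  have hP1 : closedLength w ^ 2 ≤ 1 := pow_le_one₀ (closedLength_nonneg w) hw1
  -- The normalization gives only length at most 1; maximality applied to `w` itself shows that `w`
  -- attains the ratio.
  have hww : signedArea w = signedArea w * closedLength w ^ 2 :=
    le_antisymm (hw w) (mul_le_of_le_one_right hA.le hP1)
  have heq := dist_eq_of_maximal hm hA hw hww
  have h1 := mul_le_mul_of_nonneg_left (signedArea_le_sum_sq hm w) (Nat.cast_nonneg (α := ℝ) m)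
  rw [sum_sq_eq_of_equilateral heq] at h1
  have h2 : 4 * rho m * signedArea w ≤ 1 := by
    refine le_trans (le_of_eq ?_) (h1.trans hP1)
    rw [rho]; ring
  calc 4 * rho m * signedArea v ≤ 4 * rho m * (signedArea w * closedLength v ^ 2) :=
        mul_le_mul_of_nonneg_left (hw v) (by positivity)
    _ = (4 * rho m * signedArea w) * closedLength v ^ 2 := by ring
    _ ≤ closedLength v ^ 2 := mul_le_of_le_one_left (by positivity) h2

/-- Equality in the isoperimetric inequality holds only for regular polygons. -/
theorem exists_regular_of_signedArea_eq (hm : 3 ≤ m) {v : ZMod m → ℂ}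
    (h : 4 * rho m * signedArea v = closedLength v ^ 2) :
    ∃ c b : ℂ, ∀ k, v k = c + b * ZMod.stdAddChar k := by
  have hρ := rho_pos hm
  have heq := dist_eq_of_maximal hm (A := (4 * rho m)⁻¹) (by positivity)
    (fun v => by rw [le_inv_mul_iff₀ (by positivity)]; exact signedArea_le hm v)
    (w := v) (by rw [eq_inv_mul_iff_mul_eq₀ (by positivity), h])
  refine exists_regular_of_wirtinger_eq hm v ?_
  have hm0 : (m : ℝ) ≠ 0 := NeZero.ne _
  rw [← mul_right_inj' hm0, sum_sq_eq_of_equilateral heq, ← h, rho]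
  ring

end Isoperimetric

end

section

open ComplexConjugate

/-! ### Sums along closed tours -/

/-- The sum of `f` over the pairs of consecutive entries of a list. -/
def chainSum (f : ℂ → ℂ → ℝ) : List ℂ → ℝ
  | [] => 0
  | [_] => 0
  | a :: b :: t => f a b + chainSum f (b :: t)

/-- The sum of `f` over the pairs of cyclically consecutive entries of a list. -/
def cycleSum (f : ℂ → ℂ → ℝ) : List ℂ → ℝ
  | [] => 0
  | a :: t => chainSum f (a :: (t ++ [a]))

theorem chainSum_append_cons (f : ℂ → ℂ → ℝ) (X : List ℂ) (p : ℂ) (Y : List ℂ) :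
    chainSum f (X ++ p :: Y) = chainSum f (X ++ [p]) + chainSum f (p :: Y) := by
  induction X with
  | nil => simp [chainSum]
  | cons a X ih =>
    cases X with
    | nil => simp [chainSum]
    | cons b X =>
      simp only [List.cons_append, chainSum] at ih ⊢
      rw [ih]; ring

theorem chainSum_reverse (f : ℂ → ℂ → ℝ) (l : List ℂ) :
    chainSum f l.reverse = chainSum (fun a b => f b a) l := by
  induction l with
  | nil => rfl
  | cons a t ih =>
    cases t with
    | nil => rfl
    | cons b t =>
      rw [List.reverse_cons, List.reverse_cons, List.append_assoc, List.singleton_append,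
        chainSum_append_cons, ← List.reverse_cons, ih]
      simp only [chainSum]
      ring

theorem cycleSum_append_singleton (f : ℂ → ℂ → ℝ) (a : ℂ) (t : List ℂ) :
    cycleSum f (t ++ [a]) = cycleSum f (a :: t) := by
  cases t with
  | nil => rfl
  | cons b t =>
    simp only [cycleSum, List.cons_append, List.append_assoc, chainSum]
    rw [List.nil_append, ← List.cons_append, chainSum_append_cons]
    simp only [chainSum, List.cons_append]
    ring

theorem cycleSum_append_comm (f : ℂ → ℂ → ℝ) (X Y : List ℂ) :
    cycleSum f (X ++ Y) = cycleSum f (Y ++ X) := by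
  induction X generalizing Y with
  | nil => simp
  | cons a X ih =>
    rw [List.cons_append, ← cycleSum_append_singleton, List.append_assoc, ih, List.append_assoc,
      List.singleton_append]

theorem cycleSum_reverse (f : ℂ → ℂ → ℝ) (l : List ℂ) :
    cycleSum f l.reverse = cycleSum (fun a b => f b a) l := by
  cases l with
  | nil => rfl
  | cons a t =>
    rw [List.reverse_cons, cycleSum_append_singleton]
    simp only [cycleSum]
    rw [← chainSum_reverse]
    simp

theorem cycleSum_dist_le_cons (e : ℂ) (l : List ℂ) :
    cycleSum dist l ≤ cycleSum dist (e :: l) := by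
  cases l with
  | nil => simp [cycleSum, chainSum]
  | cons b t =>
    simp only [cycleSum]
    rcases List.eq_nil_or_concat t with rfl | ⟨t', x, rfl⟩
    · simp only [List.nil_append, List.cons_append, chainSum, dist_self]
      linarith [dist_nonneg (x := e) (y := b), dist_nonneg (x := b) (y := e)]
    · have h1 := chainSum_append_cons dist (b :: t') x [b]
      have h2 := chainSum_append_cons dist (b :: t') x [e]
      simp only [List.cons_append, List.append_assoc, List.nil_append, List.concat_eq_append,
        chainSum] at h1 h2 ⊢
      rw [h1, h2]
      linarith [dist_triangle x e b]

theorem chainSum_ofFn (f : ℂ → ℂ → ℝ) (n : ℕ) (v : Fin (n + 1) → ℂ) :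
    chainSum f (List.ofFn v) = ∑ i : Fin n, f (v i.castSucc) (v i.succ) := by
  induction n with
  | zero => simp [chainSum]
  | succ n ih =>
    rw [Fin.sum_univ_succ, List.ofFn_succ, List.ofFn_succ, chainSum]
    have := ih (fun i => v i.succ)
    rw [List.ofFn_succ] at this
    rw [this]
    rfl

theorem cycleSum_ofFn (f : ℂ → ℂ → ℝ) (n : ℕ) (v : Fin (n + 1) → ℂ) :
    cycleSum f (List.ofFn v) = ∑ i : Fin (n + 1), f (v i) (v (i + 1)) := by
  have h : cycleSum f (List.ofFn v) =
      chainSum f (List.ofFn (Fin.snoc v (v 0) : Fin (n + 1 + 1) → ℂ)) := by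
    rw [List.ofFn_succ' (Fin.snoc v (v 0) : Fin (n + 1 + 1) → ℂ)]
    simp only [Fin.snoc_castSucc, Fin.snoc_last, List.concat_eq_append]
    rw [List.ofFn_succ (f := v)]
    rfl
  rw [h, chainSum_ofFn]
  refine Finset.sum_congr rfl fun i _ => ?_
  rw [Fin.snoc_castSucc]
  congr 1
  refine Fin.lastCases ?_ (fun j => ?_) i
  · rw [Fin.succ_last, Fin.snoc_last, Fin.last_add_one]
  · rw [← Fin.castSucc_succ, Fin.snoc_castSucc, Fin.coeSucc_eq_succ]

theorem cycleSum_replicate_append {f : ℂ → ℂ → ℝ} (hf : ∀ a, f a a = 0) (k : ℕ) (a : ℂ)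
    (t : List ℂ) : cycleSum f (List.replicate k a ++ a :: t) = cycleSum f (a :: t) := by
  induction k with
  | zero => rfl
  | succ k ih =>
    rw [← ih]
    cases k with
    | zero => simp [cycleSum, chainSum, hf]
    | succ k => simp [cycleSum, chainSum, hf, List.replicate_succ]

/-! ### Shortest tours through points in convex position -/

/-- A list of points none of which is a convex combination of the others. -/
def ConvexPosition (l : List ℂ) : Prop :=
  l.Nodup ∧ ∀ e ∈ l, e ∉ convexHull ℝ {x | x ∈ l ∧ x ≠ e}

theorem ConvexPosition.perm {l l' : List ℂ} (h : ConvexPosition l) (hp : l.Perm l') :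
    ConvexPosition l' := by
  refine ⟨hp.nodup_iff.1 h.1, fun e he => ?_⟩
  simpa only [hp.mem_iff] using h.2 e (hp.mem_iff.2 he)

theorem ConvexPosition.notMem_convexHull {l : List ℂ} (h : ConvexPosition l) {e : ℂ} (he : e ∈ l)
    {s : Set ℂ} (hs : ∀ x ∈ s, x ∈ l ∧ x ≠ e) : e ∉ convexHull ℝ s :=
  fun h' => h.2 e he (convexHull_mono hs h')

/-- A vertex in the hull of the remaining entries can be deleted without changing the hull, and by
the triangle inequality without lengthening the tour. A repeated vertex is such a vertex, because
`List.erase` removes only one copy. -/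
theorem exists_convexPosition (l : List ℂ) :
    ∃ l' : List ℂ, l' ⊆ l ∧ l'.length ≤ l.length ∧ cycleSum dist l' ≤ cycleSum dist l ∧
      (∀ x ∈ l, x ∈ convexHull ℝ {y | y ∈ l'}) ∧ ConvexPosition l' := by
  classical
  induction hn : l.length using Nat.strong_induction_on generalizing l with
  | _ n ih =>
    by_cases h : ∀ e ∈ l, e ∉ convexHull ℝ {x | x ∈ l.erase e}
    · refine ⟨l, fun _ h => h, hn.le, le_rfl, fun x hx => subset_convexHull ℝ _ hx, ?_, ?_⟩
      · rw [List.nodup_iff_count_le_one]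
        intro e
        by_contra! hc
        have he : e ∈ l := List.count_pos_iff.1 (by omega)
        refine h e he (subset_convexHull ℝ _ ?_)
        change e ∈ l.erase e
        rw [← List.count_pos_iff, List.count_erase_self]
        omega
      · intro e he h'
        exact h e he (convexHull_mono (fun x hx => (List.mem_erase_of_ne hx.2).2 hx.1) h')
    · push Not at h
      obtain ⟨e, he, hull⟩ := h
      obtain ⟨X, Y, rfl⟩ := List.append_of_mem he
      have hperm : ((X ++ e :: Y).erase e).Perm (Y ++ X) := by
        refine List.Perm.cons_inv (a := e) ((List.perm_cons_erase he).symm.trans ?_)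
        exact List.perm_append_comm
      obtain ⟨l', h1, h2, h3, h4, h5⟩ := ih (Y ++ X).length (by simp at hn ⊢; omega) (Y ++ X) rfl
      have hsub : convexHull ℝ {x | x ∈ (X ++ e :: Y).erase e} ⊆ convexHull ℝ {y | y ∈ l'} :=
        convexHull_min (fun x hx => h4 x (hperm.mem_iff.1 hx)) (convex_convexHull ℝ _)
      refine ⟨l', fun x hx => ?_, ?_, ?_, fun x hx => ?_, h5⟩
      · have := h1 hx
        simp only [List.mem_append, List.mem_cons] at this ⊢
        tauto
      · simp at h2 hn ⊢; omega
      · rw [cycleSum_append_comm dist X]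
        exact h3.trans (cycleSum_dist_le_cons e _)
      · by_cases hxe : x = e
        · rw [hxe]; exact hsub hull
        · exact h4 x (hperm.mem_iff.1 ((List.mem_erase_of_ne hxe).2 hx))

theorem exists_shortest_perm (l : List ℂ) :
    ∃ l' : List ℂ, l'.Perm l ∧
      ∀ l'' : List ℂ, l''.Perm l' → cycleSum dist l' ≤ cycleSum dist l'' := by
  classical
  obtain ⟨l', h1, h2⟩ := l.permutations.toFinset.exists_min_image (cycleSum dist)
    ⟨l, by simp⟩
  simp only [List.mem_toFinset, List.mem_permutations] at h1 h2
  exact ⟨l', h1, fun l'' h => h2 l'' (h.trans h1)⟩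

theorem exists_real_of_cross_eq_zero {u v : ℂ} (hu : u ≠ 0) (h : cross u v = 0) :
    ∃ t : ℝ, v = t * u := by
  refine ⟨(v / u).re, ?_⟩
  have him : (v / u).im = 0 := by
    rw [Complex.div_im]
    unfold cross at h
    rw [← sub_div, div_eq_zero_iff]
    left; linarith
  have : v / u = ((v / u).re : ℂ) := Complex.ext rfl (by simpa using him)
  rw [← this, div_mul_cancel₀ _ hu]

theorem mem_convexHull_pair {p q x : ℂ} {t : ℝ} (h0 : 0 ≤ t) (h1 : t ≤ 1)
    (hx : x = p + t * (q - p)) : x ∈ convexHull ℝ {p, q} := by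
  rw [convexHull_pair]
  refine ⟨1 - t, t, by linarith, h0, by ring, ?_⟩
  rw [hx]
  simp only [Complex.real_smul]
  push_cast
  ring

theorem mem_convexHull_pair_of_neg {a b x : ℂ} {t : ℝ} (ht : t ≤ 0)
    (hx : x = a + t * (b - a)) : a ∈ convexHull ℝ {x, b} := by
  have h1 : (0 : ℝ) < 1 - t := by linarith
  refine mem_convexHull_pair (t := -t / (1 - t)) (div_nonneg (by linarith) h1.le) ?_ ?_
  · rw [div_le_one h1]; linarith
  · have h1' : (1 : ℂ) - t ≠ 0 := by exact_mod_cast h1.ne'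
    rw [hx]
    push_cast
    field_simp
    ring

/-- Of three distinct collinear points one lies between the other two; the parameter `t` tells
which. -/
theorem ConvexPosition.cross_ne_zero {l : List ℂ} (h : ConvexPosition l) {a b p : ℂ} (ha : a ∈ l)
    (hb : b ∈ l) (hp : p ∈ l) (hab : a ≠ b) (hap : a ≠ p) (hbp : b ≠ p) :
    cross (b - a) (p - a) ≠ 0 := by
  intro h0
  obtain ⟨t, ht⟩ := exists_real_of_cross_eq_zero (sub_ne_zero.2 hab.symm) h0
  have hpt : p = a + t * (b - a) := by rw [← ht]; ring
  rcases lt_or_ge t 0 with h1 | h1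
  · refine h.notMem_convexHull ha (s := {p, b}) ?_ (mem_convexHull_pair_of_neg h1.le hpt)
    rintro x (rfl | rfl)
    exacts [⟨hp, hap.symm⟩, ⟨hb, hab.symm⟩]
  rcases le_or_gt t 1 with h2 | h2
  · refine h.notMem_convexHull hp (s := {a, b}) ?_ (mem_convexHull_pair h1 h2 hpt)
    rintro x (rfl | rfl)
    exacts [⟨ha, hap⟩, ⟨hb, hbp⟩]
  · refine h.notMem_convexHull hb (s := {p, a}) ?_
      (mem_convexHull_pair_of_neg (t := 1 - t) (by linarith) ?_)
    · rintro x (rfl | rfl)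
      exacts [⟨hp, hbp.symm⟩, ⟨ha, hab⟩]
    · rw [hpt]; push_cast; ring

/-- Replacing two crossing diagonals by two opposite sides of a quadrilateral shortens. -/
theorem dist_add_dist_lt_of_crossing {a b c d : ℂ} (ha : a ∉ convexHull ℝ {b, c, d})
    (hb : b ∉ convexHull ℝ {a, c, d})
    (hs : cross (b - a) (c - a) * cross (b - a) (d - a) < 0) :
    dist a c + dist b d < dist a b + dist c d := by
  set sc := cross (b - a) (c - a) with hsc
  set sd := cross (b - a) (d - a) with hsd
  have hab : a ≠ b := fun h => ha (subset_convexHull ℝ _ (by simp [h]))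
  have hne : sc - sd ≠ 0 := fun h => by
    have : sc = sd := by linarith
    rw [this] at hs
    nlinarith [mul_self_nonneg sd]
  set t := sc / (sc - sd) with ht
  have htmem : 0 < t ∧ t < 1 := by
    rcases lt_or_gt_of_ne hne with h | h
    · have h1 : sc < 0 := by
        by_contra! h1
        nlinarith
      refine ⟨div_pos_of_neg_of_neg h1 h, ?_⟩
      rw [ht, div_lt_one_of_neg h]
      nlinarith
    · have h1 : 0 < sc := by
        by_contra! h1
        nlinarith
      refine ⟨div_pos h1 h, ?_⟩
      rw [ht, div_lt_one h]
      nlinarith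
  set q : ℂ := c + t * (d - c) with hq
  have hcq : cross (b - a) (q - a) = 0 := by
    have : cross (b - a) (q - a) = sc + t * (sd - sc) := by
      rw [hq, hsc, hsd]
      simp [cross]
      ring
    rw [this, ht]
    field_simp
    ring
  obtain ⟨u, hu⟩ := exists_real_of_cross_eq_zero (sub_ne_zero.2 hab.symm) hcq
  have hqu : q = a + u * (b - a) := by rw [← hu]; ring
  have hqcd : q ∈ convexHull ℝ {c, d} := mem_convexHull_pair htmem.1.le htmem.2.le hq
  -- The meeting point is strictly between `a` and `b`: otherwise one of these would lie in the hull
  -- of the other three points.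
  have hu0 : 0 < u := by
    by_contra! h
    refine ha (convexHull_min ?_ (convex_convexHull ℝ _) (mem_convexHull_pair_of_neg h hqu))
    rintro x (rfl | rfl)
    · exact convexHull_mono (by intro x; simp; tauto) hqcd
    · exact subset_convexHull ℝ _ (by simp)
  have hu1 : u < 1 := by
    by_contra! h
    refine hb (convexHull_min ?_ (convex_convexHull ℝ _)
      (mem_convexHull_pair_of_neg (t := 1 - u) (x := q) (b := a) (by linarith) ?_))
    · rintro x (rfl | rfl)
      · exact convexHull_mono (by intro x; simp; tauto) hqcd
      · exact subset_convexHull ℝ _ (by simp)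
    · rw [hqu]; push_cast; ring
  have h1 : dist a q + dist q b = dist a b := by
    rw [dist_eq_norm, dist_eq_norm, dist_eq_norm, hqu,
      show a - (a + u * (b - a)) = (u : ℂ) * (a - b) by ring,
      show a + u * (b - a) - b = ((1 - u : ℝ) : ℂ) * (a - b) by push_cast; ring,
      norm_mul, norm_mul, Complex.norm_real, Complex.norm_real, Real.norm_of_nonneg hu0.le,
      Real.norm_of_nonneg (by linarith)]
    ring
  have h2 : dist c q + dist q d = dist c d := by
    rw [dist_eq_norm, dist_eq_norm, dist_eq_norm, hq,
      show c - (c + t * (d - c)) = (t : ℂ) * (c - d) by ring,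
      show c + t * (d - c) - d = ((1 - t : ℝ) : ℂ) * (c - d) by push_cast; ring,
      norm_mul, norm_mul, Complex.norm_real, Complex.norm_real, Real.norm_of_nonneg htmem.1.le,
      Real.norm_of_nonneg (by linarith [htmem.2])]
    ring
  -- Strictness: equality would put `q` on the segment `ac`, hence either `q = a` or `c` on the line
  -- `ab`.
  have h3 : dist a c < dist a q + dist q c := by
    refine lt_of_le_of_ne (dist_triangle _ _ _) fun h => ?_
    obtain ⟨r, hr, hr'⟩ := dist_add_dist_eq_iff.1 h.symm
    have hr2 : q - a = (r : ℂ) * (c - a) := by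
      rw [← hr', AffineMap.lineMap_apply]
      simp
    have h0 : cross (b - a) (q - a) = r * sc := by
      rw [hr2, hsc]; simp [cross]; ring
    rw [hcq] at h0
    rcases mul_eq_zero.1 h0.symm with h0 | h0
    · rw [h0, Complex.ofReal_zero, zero_mul, hu] at hr2
      rcases mul_eq_zero.1 hr2 with h4 | h4
      · exact hu0.ne' (by exact_mod_cast h4)
      · exact hab (sub_eq_zero.1 h4).symm
    · rw [h0] at hs; simp at hs
  have h4 := dist_triangle b q d
  rw [dist_comm b q] at h4
  rw [dist_comm q c] at h3
  linarith

theorem exists_sign_change (s : ℂ → ℝ) (R : List ℂ) (h : ∀ p ∈ R, s p ≠ 0) :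
    (∀ p ∈ R, 0 < s p) ∨ (∀ p ∈ R, s p < 0) ∨
      ∃ X c d Y, R = X ++ c :: d :: Y ∧ s c * s d < 0 := by
  induction R with
  | nil => simp
  | cons a R ih =>
    cases R with
    | nil =>
      rcases lt_or_gt_of_ne (h a (by simp)) with h | h
      · exact Or.inr (Or.inl (by simpa using h))
      · exact Or.inl (by simpa using h)
    | cons b R =>
      have ha := h a (by simp)
      rcases ih fun p hp => h p (List.mem_cons_of_mem _ hp) with h1 | h1 | ⟨X, c, d, Y, h1, h2⟩
      · rcases lt_or_gt_of_ne ha with h' | h'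
        · exact Or.inr (Or.inr ⟨[], a, b, R, rfl, mul_neg_of_neg_of_pos h' (h1 b (by simp))⟩)
        · left
          intro p hp
          rcases List.mem_cons.1 hp with rfl | hp
          exacts [h', h1 p hp]
      · rcases lt_or_gt_of_ne ha with h' | h'
        · right; left
          intro p hp
          rcases List.mem_cons.1 hp with rfl | hp
          exacts [h', h1 p hp]
        · exact Or.inr (Or.inr ⟨[], a, b, R, rfl, mul_neg_of_pos_of_neg h' (h1 b (by simp))⟩)
      · exact Or.inr (Or.inr ⟨a :: X, c, d, Y, by rw [h1]; rfl, h2⟩)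

/-- A list of points in convex position whose closed tour is shortest among all reorderings. -/
def IsShortest (l : List ℂ) : Prop :=
  ConvexPosition l ∧ ∀ l' : List ℂ, l'.Perm l → cycleSum dist l ≤ cycleSum dist l'

theorem IsShortest.append_comm {X Y : List ℂ} (h : IsShortest (X ++ Y)) : IsShortest (Y ++ X) :=
  ⟨h.1.perm List.perm_append_comm, fun l' hl' => by
    rw [cycleSum_append_comm]
    exact h.2 l' (hl'.trans List.perm_append_comm)⟩

theorem IsShortest.reverse {l : List ℂ} (h : IsShortest l) : IsShortest l.reverse :=
  ⟨h.1.perm l.reverse_perm.symm, fun l' hl' => by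
    rw [cycleSum_reverse]
    simp only [dist_comm]
    have := h.2 l' (hl'.trans l.reverse_perm)
    simpa only [dist_comm] using this⟩

/-- All the other points of a shortest tour lie strictly on one side of each of its edges. -/
theorem IsShortest.same_side {a b : ℂ} {R : List ℂ} (h : IsShortest (b :: (R ++ [a]))) :
    (∀ p ∈ R, 0 < cross (b - a) (p - a)) ∨ (∀ p ∈ R, cross (b - a) (p - a) < 0) := by
  have hnd := h.1.1
  simp only [List.nodup_cons, List.mem_append, List.mem_singleton, not_or, List.nodup_append,
    List.nodup_nil, List.not_mem_nil] at hnd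
  obtain ⟨⟨hbR, hba⟩, -, -, hRa⟩ := hnd
  have hR : ∀ p ∈ R, p ∈ b :: (R ++ [a]) := fun p hp => by simp [hp]
  have hRa' : ∀ p ∈ R, a ≠ p := fun p hp => (hRa p hp a rfl).symm
  have hbR' : ∀ p ∈ R, b ≠ p := fun p hp hbp => hbR (hbp ▸ hp)
  have hb : b ∈ b :: (R ++ [a]) := by simp
  have ha : a ∈ b :: (R ++ [a]) := by simp
  rcases exists_sign_change (fun p => cross (b - a) (p - a)) R fun p hp =>
    h.1.cross_ne_zero ha hb (hR p hp) (Ne.symm hba) (hRa' p hp) (hbR' p hp)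
    with h1 | h1 | ⟨X, c, d, Y, rfl, h2⟩
  · exact Or.inl h1
  · exact Or.inr h1
  exfalso
  have hc : c ∈ X ++ c :: d :: Y := by simp
  have hd : d ∈ X ++ c :: d :: Y := by simp
  have hlt := dist_add_dist_lt_of_crossing (a := a) (b := b) (c := c) (d := d)
    (h.1.notMem_convexHull ha (by
      rintro x (rfl | rfl | rfl)
      exacts [⟨hb, hba⟩, ⟨hR _ hc, (hRa' _ hc).symm⟩, ⟨hR _ hd, (hRa' _ hd).symm⟩]))
    (h.1.notMem_convexHull hb (by
      rintro x (rfl | rfl | rfl)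
      exacts [⟨ha, Ne.symm hba⟩, ⟨hR _ hc, (hbR' _ hc).symm⟩, ⟨hR _ hd, (hbR' _ hd).symm⟩])) h2
  -- Traversing the stretch from `b` to `c` backwards replaces the edges `ab` and `cd` by `ac` and
  -- `bd`.
  have hperm : (c :: (X.reverse ++ b :: d :: (Y ++ [a]))).Perm
      (b :: (X ++ c :: d :: Y ++ [a])) := by
    rw [List.perm_iff_count]
    intro x
    simp only [List.count_cons, List.count_append, List.count_reverse, List.count_nil]
    omega
  have hle := h.2 _ hperm
  have e1 : cycleSum dist (b :: (X ++ c :: d :: Y ++ [a])) =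
      chainSum dist (b :: (X ++ [c])) + dist c d + chainSum dist (d :: (Y ++ [a])) + dist a b := by
    have h1 := chainSum_append_cons dist (b :: X) c (d :: (Y ++ [a, b]))
    have h2 := chainSum_append_cons dist (d :: Y) a [b]
    simp only [cycleSum, List.cons_append, List.append_assoc, List.nil_append, chainSum] at h1 h2 ⊢
    rw [h1, h2]
    ring
  have e2 : cycleSum dist (c :: (X.reverse ++ b :: d :: (Y ++ [a]))) =
      chainSum dist (b :: (X ++ [c])) + dist b d + chainSum dist (d :: (Y ++ [a])) + dist a c := by
    have h1 := chainSum_append_cons dist (c :: X.reverse) b (d :: (Y ++ [a, c]))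
    have h2 := chainSum_append_cons dist (d :: Y) a [c]
    have h3 := chainSum_reverse dist (b :: (X ++ [c]))
    simp only [cycleSum, List.cons_append, List.append_assoc, List.nil_append, chainSum,
      List.reverse_cons, List.reverse_append, List.reverse_nil] at h1 h2 h3 ⊢
    rw [h1, h2, h3]
    simp only [dist_comm]
    ring
  rw [e1, e2] at hle
  linarith

/-- All the other points lie strictly to the left of the edge that closes the tour. -/
def IsLeft (l : List ℂ) : Prop :=
  ∀ b R a, l = b :: (R ++ [a]) → ∀ p ∈ R, 0 < cross (b - a) (p - a)

/-- The next edge also has all other points on one side. The triangle formed by these two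
consecutive edges has one orientation, which decides that the side is again the left. -/
theorem IsShortest.isLeft_rotate {b : ℂ} {t : List ℂ} (h : IsShortest (b :: t))
    (hl : IsLeft (b :: t)) : IsLeft (t ++ [b]) := by
  intro c R' b' heq p hp
  cases t with
  | nil => simp at heq
  | cons c' t =>
    rw [List.cons_append, List.cons.injEq] at heq
    obtain ⟨rfl, heq⟩ := heq
    obtain ⟨rfl, hb⟩ := List.append_inj' heq rfl
    simp only [List.cons.injEq, and_true] at hb
    subst hb
    rcases List.eq_nil_or_concat t with rfl | ⟨R, a, rfl⟩
    · simp at hp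
    rw [List.concat_eq_append] at h hl hp
    have h1 := hl b (c' :: R) a rfl c' (by simp)
    have h2 : 0 < cross (c' - b) (a - b) := by
      rw [cross_sub_sub] at h1 ⊢
      linarith
    have hs : IsShortest ([b] ++ (c' :: (R ++ [a]))) := h
    rcases hs.append_comm.same_side with h3 | h3
    · exact h3 p hp
    · exact absurd (h3 a (by simp)) h2.not_gt

theorem IsShortest.isLeft_append_comm {X Y : List ℂ} (h : IsShortest (X ++ Y))
    (hl : IsLeft (X ++ Y)) : IsLeft (Y ++ X) := by
  induction X generalizing Y with
  | nil => simpa using hl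
  | cons a X ih =>
    have h1 : IsShortest ([a] ++ (X ++ Y)) := h
    have h2 := h1.append_comm
    have h3 : IsLeft (X ++ Y ++ [a]) := IsShortest.isLeft_rotate h hl
    rw [List.append_assoc] at h2 h3
    have := ih h2 h3
    rwa [List.append_assoc, List.singleton_append] at this

/-- Every point of the list lies to the left of every edge of its closed tour. -/
def IsConvexTour : List ℂ → Prop
  | [] => True
  | a :: t => ∀ X p q Y, a :: (t ++ [a]) = X ++ p :: q :: Y →
      ∀ x ∈ a :: t, 0 ≤ cross (q - p) (x - p)

theorem IsShortest.isConvexTour {l : List ℂ} (h : IsShortest l) (hl : IsLeft l) :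
    IsConvexTour l := by
  cases l with
  | nil => trivial
  | cons a t =>
    intro X p q Y heq x hx
    have key : ∀ R, (q :: (R ++ [p])).Perm (a :: t) → IsLeft (q :: (R ++ [p])) →
        0 ≤ cross (q - p) (x - p) := by
      intro R hperm hleft
      have hx' := hperm.mem_iff.2 hx
      simp only [List.mem_cons, List.mem_append, List.not_mem_nil, or_false] at hx'
      rcases hx' with rfl | hx' | rfl
      · rw [cross_self]
      · exact (hleft q R p rfl x hx').le
      · simp [cross]
    -- With `Y` empty, `pq` is already the closing edge; any other edge is rotated into that
    -- position.
    rcases List.eq_nil_or_concat Y with rfl | ⟨Y, y, rfl⟩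
    · have e : (a :: t) ++ [a] = (X ++ [p]) ++ [q] := by simpa using heq
      obtain ⟨e1, e2⟩ := List.append_inj' e rfl
      simp only [List.cons.injEq, and_true] at e2
      subst e2
      cases X with
      | nil =>
        simp only [List.nil_append, List.cons.injEq] at e1
        rw [e1.1]
        simp [cross]
      | cons a' X =>
        simp only [List.cons_append, List.cons.injEq] at e1
        obtain ⟨rfl, rfl⟩ := e1
        exact key X (List.Perm.refl _) hl
    · have e : (a :: t) ++ [a] = (X ++ p :: q :: Y) ++ [y] := by simpa using heq
      obtain ⟨e1, -⟩ := List.append_inj' e rfl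
      have e3 : a :: t = (X ++ [p]) ++ (q :: Y) := by simpa using e1
      rw [e3] at h hl
      have := h.isLeft_append_comm hl
      refine key (Y ++ X) ?_ ?_
      · rw [e3, List.append_assoc, ← List.cons_append]
        exact List.perm_append_comm
      · rw [List.append_assoc, ← List.cons_append]
        exact this

/-- The points of a closed tour can be reordered, after discarding some of them, to a convex tour
that is not longer and has the same convex hull. -/
theorem exists_isConvexTour (l : List ℂ) :
    ∃ l' : List ℂ, l' ⊆ l ∧ l'.length ≤ l.length ∧ cycleSum dist l' ≤ cycleSum dist l ∧
      (∀ x ∈ l, x ∈ convexHull ℝ {y | y ∈ l'}) ∧ IsConvexTour l' := by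
  obtain ⟨l₁, h1, h2, h3, h4, h5⟩ := exists_convexPosition l
  obtain ⟨l₂, h6, h7⟩ := exists_shortest_perm l₁
  have hs : IsShortest l₂ := ⟨h5.perm h6.symm, h7⟩
  have key : ∀ l' : List ℂ, l'.Perm l₂ → cycleSum dist l' = cycleSum dist l₂ → IsShortest l' →
      IsLeft l' → l' ⊆ l ∧ l'.length ≤ l.length ∧ cycleSum dist l' ≤ cycleSum dist l ∧
      (∀ x ∈ l, x ∈ convexHull ℝ {y | y ∈ l'}) ∧ IsConvexTour l' := by
    intro l' hp he hs' hl
    have hp1 := hp.trans h6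
    refine ⟨fun x hx => h1 (hp1.mem_iff.1 hx), hp1.length_eq.trans_le h2, ?_, ?_,
      hs'.isConvexTour hl⟩
    · rw [he]
      exact (h7 _ h6.symm).trans h3
    · simpa only [hp1.mem_iff] using h4
  by_cases hl : IsLeft l₂
  · exact ⟨l₂, key l₂ (List.Perm.refl _) rfl hs hl⟩
  -- If the closing edge does not have all points on its left, it has them all on its right, and
  -- reversing the tour exchanges the sides.
  · refine ⟨l₂.reverse, key _ l₂.reverse_perm ?_ hs.reverse ?_⟩
    · rw [cycleSum_reverse]; simp only [dist_comm]
    · unfold IsLeft at hl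
      push Not at hl
      obtain ⟨b, R, a, rfl, p, hp, hle⟩ := hl
      intro b' R' a' heq x hx
      simp only [List.reverse_cons, List.reverse_append, List.reverse_nil, List.nil_append,
        List.cons_append, List.cons.injEq] at heq
      obtain ⟨rfl, heq⟩ := heq
      obtain ⟨rfl, e2⟩ := List.append_inj' heq rfl
      simp only [List.cons.injEq, and_true] at e2
      subst e2
      rcases hs.same_side with h' | h'
      · exact absurd (h' p hp) hle.not_gt
      · have h8 := h' x (by simpa using hx)
        have : cross (a - b) (x - b) = - cross (b - a) (x - a) := by
          simp only [cross, Complex.sub_re, Complex.sub_im]; ring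
        linarith

end

section

open MeasureTheory

/-! ### The area of the convex hull of a tour -/

/-- The triangle with vertices `c`, `p` and `q`. -/
def triangle (c p q : ℂ) : Set ℂ :=
  {x | ∃ α β : ℝ, 0 ≤ α ∧ 0 ≤ β ∧ α + β ≤ 1 ∧ x = c + (α * (p - c) + β * (q - c))}

theorem volume_standard_triangle :
    (volume : Measure (ℝ × ℝ)) {p : ℝ × ℝ | 0 ≤ p.1 ∧ 0 ≤ p.2 ∧ p.1 + p.2 ≤ 1} =
      ENNReal.ofReal (1 / 2) := by
  have hcl : IsClosed {p : ℝ × ℝ | 0 ≤ p.1 ∧ 0 ≤ p.2 ∧ p.1 + p.2 ≤ 1} :=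
    (isClosed_le continuous_const continuous_fst).inter
      ((isClosed_le continuous_const continuous_snd).inter
        (isClosed_le (continuous_fst.add continuous_snd) continuous_const))
  rw [Measure.volume_eq_prod, Measure.prod_apply hcl.measurableSet]
  have hsec : ∀ x : ℝ, volume (Prod.mk x ⁻¹' {p : ℝ × ℝ | 0 ≤ p.1 ∧ 0 ≤ p.2 ∧ p.1 + p.2 ≤ 1}) =
      (Set.Icc (0 : ℝ) 1).indicator (fun x => ENNReal.ofReal (1 - x)) x := by
    intro x
    by_cases hx : x ∈ Set.Icc (0 : ℝ) 1
    · rw [Set.indicator_of_mem hx]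
      have : Prod.mk x ⁻¹' {p : ℝ × ℝ | 0 ≤ p.1 ∧ 0 ≤ p.2 ∧ p.1 + p.2 ≤ 1} =
          Set.Icc 0 (1 - x) := by
        ext y
        simp only [Set.mem_preimage, Set.mem_ofPred_eq, Set.mem_Icc]
        constructor
        · rintro ⟨-, h1, h2⟩; exact ⟨h1, by linarith⟩
        · rintro ⟨h1, h2⟩; exact ⟨hx.1, h1, by linarith⟩
      rw [this, Real.volume_Icc, sub_zero]
    · rw [Set.indicator_of_notMem hx]
      have : Prod.mk x ⁻¹' {p : ℝ × ℝ | 0 ≤ p.1 ∧ 0 ≤ p.2 ∧ p.1 + p.2 ≤ 1} = ∅ := by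
        ext y
        simp only [Set.mem_preimage, Set.mem_ofPred_eq, Set.mem_empty_iff_false, iff_false]
        rintro ⟨h0, h1, h2⟩
        exact hx ⟨h0, by linarith⟩
      rw [this, measure_empty]
  simp only [hsec]
  rw [lintegral_indicator measurableSet_Icc, ← ofReal_integral_eq_lintegral_ofReal]
  · rw [integral_Icc_eq_integral_Ioc, ← intervalIntegral.integral_of_le zero_le_one]
    congr 1
    rw [intervalIntegral.integral_sub (by simp) (by simp), integral_id]
    norm_num
  · exact (by fun_prop : Continuous fun x : ℝ => 1 - x).continuousOn.integrableOn_Icc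
  · filter_upwards [ae_restrict_mem measurableSet_Icc] with x hx
    exact sub_nonneg.2 hx.2

theorem volume_triangle (c p q : ℂ) :
    volume (triangle c p q) = ENNReal.ofReal (|cross (p - c) (q - c)| / 2) := by
  set D : Set ℂ := {z | 0 ≤ z.re ∧ 0 ≤ z.im ∧ z.re + z.im ≤ 1} with hD
  have hvol : volume D = ENNReal.ofReal (1 / 2) := by
    rw [← volume_standard_triangle,
      ← Complex.volume_preserving_equiv_real_prod.measure_preimage_equiv]
    rfl
  let L : ℂ →ₗ[ℝ] ℂ :=
    Complex.reLm.smulRight (p - c) + Complex.imLm.smulRight (q - c)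
  have hL : ∀ z : ℂ, L z = z.re * (p - c) + z.im * (q - c) := fun z => by simp [L]
  have hdet : LinearMap.det L = cross (p - c) (q - c) := by
    rw [← LinearMap.det_toMatrix Complex.basisOneI, Matrix.det_fin_two]
    simp [LinearMap.toMatrix_apply, hL, cross]
    ring
  have himg : triangle c p q = (fun x => c + x) '' (L '' D) := by
    ext x
    simp only [triangle, Set.mem_ofPred_eq, Set.mem_image, exists_exists_and_eq_and, hL]
    constructor
    · rintro ⟨α, β, h0, h1, h2, rfl⟩
      exact ⟨⟨α, β⟩, ⟨h0, h1, h2⟩, rfl⟩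
    · rintro ⟨z, ⟨h0, h1, h2⟩, rfl⟩
      exact ⟨z.re, z.im, h0, h1, h2, rfl⟩
  rw [himg, Set.image_add_left, measure_preimage_add, Measure.addHaar_image_linearMap, hvol, hdet,
    ← ENNReal.ofReal_mul (abs_nonneg _)]
  congr 1
  ring

theorem chainSum_nonneg {f : ℂ → ℂ → ℝ} (hf : ∀ a b, 0 ≤ f a b) (l : List ℂ) :
    0 ≤ chainSum f l := by
  induction l with
  | nil => exact le_rfl
  | cons a t ih =>
    cases t with
    | nil => exact le_rfl
    | cons b t => exact add_nonneg (hf a b) ih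

theorem chainSum_congr {f g : ℂ → ℂ → ℝ} {l : List ℂ}
    (h : ∀ X p q Y, l = X ++ p :: q :: Y → f p q = g p q) : chainSum f l = chainSum g l := by
  induction l with
  | nil => rfl
  | cons a t ih =>
    cases t with
    | nil => rfl
    | cons b t =>
      rw [chainSum, chainSum, h [] a b t rfl, ih]
      intro X p q Y hl
      exact h (a :: X) p q Y (by rw [hl]; rfl)

theorem volume_triangles_le (c : ℂ) (l : List ℂ) :
    volume {x | ∃ X p q Y, l = X ++ p :: q :: Y ∧ x ∈ triangle c p q} ≤
      ENNReal.ofReal (chainSum (fun p q => |cross (p - c) (q - c)| / 2) l) := by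
  induction l with
  | nil => simp
  | cons a t ih =>
    cases t with
    | nil =>
      have : {x | ∃ X p q Y, [a] = X ++ p :: q :: Y ∧ x ∈ triangle c p q} = ∅ := by
        ext x
        simp only [Set.mem_ofPred_eq, Set.mem_empty_iff_false, iff_false]
        rintro ⟨X, p, q, Y, h, -⟩
        have := congrArg List.length h
        simp only [List.length_cons, List.length_nil, List.length_append] at this
        omega
      rw [this]
      simp
    | cons b t =>
      rw [chainSum,
        ENNReal.ofReal_add (by positivity) (chainSum_nonneg (fun _ _ => by positivity) _),
        ← volume_triangle]
      refine le_trans (measure_mono ?_) ((measure_union_le _ _).trans (add_le_add_right ih _))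
      rintro x ⟨X, p, q, Y, h, hx⟩
      cases X with
      | nil =>
        simp only [List.nil_append, List.cons.injEq] at h
        obtain ⟨rfl, rfl, -⟩ := h
        exact Or.inl hx
      | cons a' X =>
        simp only [List.cons_append, List.cons.injEq] at h
        exact Or.inr ⟨X, p, q, Y, h.2, hx⟩

/-- A small step from `c` in the direction `-I * u` stays in the hull and lowers the cross product
by a positive multiple of `normSq u`. -/
theorem cross_pos_of_mem_interior {s : Set ℂ} {c u c' : ℂ} (hc : c ∈ interior (convexHull ℝ s))
    (hu : u ≠ 0) (h : ∀ y ∈ s, 0 ≤ cross u (y - c')) : 0 < cross u (c - c') := by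
  have hlin : IsLinearMap ℝ (cross u) :=
    ⟨fun x y => by simp [cross]; ring, fun r x => by simp [cross]; ring⟩
  have hsub : ∀ x y, cross u (x - y) = cross u x - cross u y := fun x y => hlin.map_sub x y
  have hhull : ∀ y ∈ convexHull ℝ s, 0 ≤ cross u (y - c') := by
    intro y hy
    have : convexHull ℝ s ⊆ {y | cross u c' ≤ cross u y} :=
      convexHull_min (fun y hy => by have := h y hy; rw [hsub] at this; exact sub_nonneg.1 this)
        (convex_halfSpace_ge hlin _)
    rw [hsub]
    exact sub_nonneg.2 (this hy)
  have hpos : 0 < Complex.normSq u := Complex.normSq_pos.2 hu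
  have hcont : Filter.Tendsto (fun ε : ℝ => c - ε * (Complex.I * u)) (nhds 0) (nhds c) := by
    have : Continuous fun ε : ℝ => c - ε * (Complex.I * u) := by fun_prop
    simpa using this.tendsto 0
  have hev := hcont.eventually (mem_interior_iff_mem_nhds.1 hc)
  obtain ⟨ε, hε, hε'⟩ := (Filter.Eventually.and (hev.filter_mono nhdsWithin_le_nhds)
    (self_mem_nhdsWithin : Set.Ioi (0 : ℝ) ∈ nhdsWithin 0 (Set.Ioi 0))).exists
  have h1 := hhull _ hε
  have h2 : cross u (c - ε * (Complex.I * u) - c') = cross u (c - c') - ε * Complex.normSq u := by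
    rw [Complex.normSq_apply]
    simp [cross]
    ring
  rw [h2] at h1
  have := mul_pos (Set.mem_Ioi.1 hε') hpos
  linarith

theorem exists_descent_of_cons (s : ℂ → ℝ) (x : ℂ) (B : List ℂ) (hx : 0 ≤ s x)
    (hB : ∃ y ∈ B, s y < 0) :
    ∃ X p q Y, x :: B = X ++ p :: q :: Y ∧ 0 ≤ s p ∧ s q < 0 := by
  induction B generalizing x with
  | nil => simp at hB
  | cons b B ih =>
    rcases lt_or_ge (s b) 0 with hb | hb
    · exact ⟨[], x, b, B, rfl, hx, hb⟩
    · obtain ⟨y, hy, hy'⟩ := hB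
      rcases List.mem_cons.1 hy with rfl | hy
      · exact absurd hy' hb.not_gt
      · obtain ⟨X, p, q, Y, h, h'⟩ := ih b hb ⟨y, hy, hy'⟩
        exact ⟨x :: X, p, q, Y, by rw [h]; rfl, h'⟩

theorem exists_descent (s : ℂ → ℝ) (a : ℂ) (t : List ℂ) (h0 : ∃ x ∈ a :: t, 0 ≤ s x)
    (h1 : ∃ y ∈ a :: t, s y < 0) :
    ∃ X p q Y, a :: (t ++ [a]) = X ++ p :: q :: Y ∧ 0 ≤ s p ∧ s q < 0 := by
  rcases lt_or_ge (s a) 0 with ha | ha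
  · obtain ⟨x, hx, hx'⟩ := h0
    rcases List.mem_cons.1 hx with rfl | hx
    · exact absurd ha hx'.not_gt
    · obtain ⟨t₁, t₂, rfl⟩ := List.append_of_mem hx
      obtain ⟨X, p, q, Y, h, h'⟩ := exists_descent_of_cons s x (t₂ ++ [a]) hx' ⟨a, by simp, ha⟩
      exact ⟨a :: t₁ ++ X, p, q, Y, by simp [h], h'⟩
  · obtain ⟨y, hy, hyneg⟩ := h1
    rcases List.mem_cons.1 hy with rfl | hy
    · exact absurd hyneg ha.not_gt
    · exact exists_descent_of_cons s a (t ++ [a]) ha ⟨y, by simp [hy], hyneg⟩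

/-- The convex hull of a convex tour is covered by the triangles which its edges span with an
interior point. -/
theorem IsConvexTour.exists_mem_triangle {a : ℂ} {t : List ℂ} (h : IsConvexTour (a :: t)) {c x : ℂ}
    (hc : c ∈ interior (convexHull ℝ {y | y ∈ a :: t})) (hx : x ∈ convexHull ℝ {y | y ∈ a :: t}) :
    ∃ X p q Y, a :: (t ++ [a]) = X ++ p :: q :: Y ∧ x ∈ triangle c p q := by
  by_cases hxc : x = c
  · subst hxc
    cases t with
    | nil => exact ⟨[], a, a, [], rfl, 0, 0, le_rfl, le_rfl, by simp, by simp⟩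
    | cons b t => exact ⟨[], a, b, t ++ [a], rfl, 0, 0, le_rfl, le_rfl, by simp, by simp⟩
  have hanti : ∀ u v : ℂ, cross u v = - cross v u := fun u v => by simp [cross]; ring
  -- The edge met by the ray from `c` through `x`: there the side of the ray changes. Were all
  -- vertices on one side, `c` would not be interior.
  obtain ⟨X, p, q, Y, heq, hp, hq⟩ := exists_descent (fun y => cross (y - c) (x - c)) a t
    (by
      by_contra! hneg
      have := cross_pos_of_mem_interior (u := x - c) (c' := c) hc (sub_ne_zero.2 hxc)
        fun y hy => by rw [hanti]; exact (neg_pos.2 (hneg y hy)).le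
      simp [cross] at this)
    (by
      by_contra! hpos
      have := cross_pos_of_mem_interior (u := c - x) (c' := c) hc (sub_ne_zero.2 (Ne.symm hxc))
        fun y hy => by
          have h1 := hpos y hy
          have h2 : cross (c - x) (y - c) = cross (y - c) (x - c) := by
            simp only [cross, Complex.sub_re, Complex.sub_im]; ring
          rwa [h2]
      simp [cross] at this)
  refine ⟨X, p, q, Y, heq, ?_⟩
  have hleft := h X p q Y heq
  have hpq : q - p ≠ 0 := fun h0 => by
    rw [sub_eq_zero.1 h0] at hq
    exact absurd hq hp.not_gt
  have hcpos := cross_pos_of_mem_interior hc hpq hleft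
  have hxnn : 0 ≤ cross (q - p) (x - p) := by
    have hlin : IsLinearMap ℝ (cross (q - p)) :=
      ⟨fun x y => by simp [cross]; ring, fun r x => by simp [cross]; ring⟩
    have : convexHull ℝ {y | y ∈ a :: t} ⊆ {y | cross (q - p) p ≤ cross (q - p) y} :=
      convexHull_min (fun y hy => by
        have := hleft y hy
        rw [hlin.map_sub] at this
        exact sub_nonneg.1 this) (convex_halfSpace_ge hlin _)
    rw [hlin.map_sub]
    exact sub_nonneg.2 (this hx)
  have hW : cross (q - p) (c - p) = cross (p - c) (q - c) := by
    simp only [cross, Complex.sub_re, Complex.sub_im]; ring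
  rw [hW] at hcpos
  set W := cross (p - c) (q - c) with hWdef
  have hsum : cross (q - p) (x - p) = W - cross (x - c) (q - c) - cross (p - c) (x - c) := by
    simp only [hWdef, cross, Complex.sub_re, Complex.sub_im]; ring
  have hq' : 0 ≤ cross (x - c) (q - c) := by
    rw [hanti]; exact (neg_pos.2 hq).le
  -- Cramer's rule. The two coordinates are nonnegative by the choice of the edge, and their sum is
  -- at most 1 because `x` is to the left of `pq`.
  refine ⟨cross (x - c) (q - c) / W, cross (p - c) (x - c) / W, div_nonneg hq' hcpos.le,
    div_nonneg hp hcpos.le, ?_, ?_⟩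
  · rw [← add_div, div_le_one hcpos]
    linarith
  · have hWne : (W : ℂ) ≠ 0 := by exact_mod_cast hcpos.ne'
    have key : (W : ℂ) * (x - c) =
        cross (x - c) (q - c) * (p - c) + cross (p - c) (x - c) * (q - c) := by
      rw [hWdef]
      apply Complex.ext
      · simp [cross]; ring
      · simp [cross]; ring
    rw [← sub_eq_iff_eq_add', ← mul_right_inj' hWne, key]
    push_cast
    field_simp

/-- An interior point is to the left of every edge, so all triangles are positively oriented and
absolute values can be dropped. Covering suffices; disjointness is not needed. -/
theorem IsConvexTour.volume_le {a : ℂ} {t : List ℂ} (h : IsConvexTour (a :: t)) {c : ℂ}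
    (hc : c ∈ interior (convexHull ℝ {y | y ∈ a :: t})) :
    (volume (convexHull ℝ {y | y ∈ a :: t})).toReal ≤
      cycleSum (fun p q => cross (p - c) (q - c) / 2) (a :: t) := by
  have h1 : chainSum (fun p q => |cross (p - c) (q - c)| / 2) (a :: (t ++ [a])) =
      cycleSum (fun p q => cross (p - c) (q - c) / 2) (a :: t) := by
    refine chainSum_congr fun X p q Y heq => ?_
    have hleft := h X p q Y heq
    have hW : cross (q - p) (c - p) = cross (p - c) (q - c) := by
      simp only [cross, Complex.sub_re, Complex.sub_im]; ring
    rw [abs_of_nonneg]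
    rw [← hW]
    by_cases hpq : q - p = 0
    · rw [hpq]; simp [cross]
    · exact (cross_pos_of_mem_interior hc hpq hleft).le
  rw [← h1]
  refine ENNReal.toReal_le_of_le_ofReal (chainSum_nonneg (fun _ _ => by positivity) _) ?_
  refine le_trans (measure_mono ?_) (volume_triangles_le c _)
  exact fun x hx => h.exists_mem_triangle hc hx

section

variable {m : ℕ} [NeZero m]

theorem exists_ofFn_eq (l : List ℂ) (h : l.length = m) :
    ∃ w : ZMod m → ℂ, Set.range w = {x | x ∈ l} ∧
      ∀ f : ℂ → ℂ → ℝ, ∑ k, f (w k) (w (k + 1)) = cycleSum f l := by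
  obtain ⟨n, rfl⟩ : ∃ n, m = n + 1 := Nat.exists_eq_succ_of_ne_zero (NeZero.ne m)
  have : ∃ w : Fin (n + 1) → ℂ, List.ofFn w = l := by
    rw [← h]
    exact ⟨l.get, List.ofFn_get l⟩
  obtain ⟨w, rfl⟩ := this
  refine ⟨w, ?_, fun f => (cycleSum_ofFn f n w).symm⟩
  ext x
  exact List.mem_ofFn.symm

theorem sum_eq_cycleSum (z : ZMod m → ℂ) :
    ∃ l : List ℂ, l.length = m ∧ {x | x ∈ l} = Set.range z ∧
      ∀ f : ℂ → ℂ → ℝ, ∑ k, f (z k) (z (k + 1)) = cycleSum f l := by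
  obtain ⟨n, rfl⟩ : ∃ n, m = n + 1 := Nat.exists_eq_succ_of_ne_zero (NeZero.ne m)
  refine ⟨List.ofFn (n := n + 1) z, List.length_ofFn, ?_, fun f => (cycleSum_ofFn f n z).symm⟩
  ext x
  exact List.mem_ofFn

/-- The convex hull of a closed polygon has at most the signed area of a closed polygon which is
not longer and whose vertices are among those of the given one. -/
theorem exists_volume_convexHull_le (z : ZMod m → ℂ) :
    ∃ w : ZMod m → ℂ, Set.range w ⊆ Set.range z ∧ closedLength w ≤ closedLength z ∧
      (volume (convexHull ℝ (Set.range z))).toReal ≤ signedArea w := by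
  rcases (interior (convexHull ℝ (Set.range z))).eq_empty_or_nonempty with hempty | ⟨c, hc⟩
  -- A hull without interior is its own frontier, which is null for a convex set; a constant polygon
  -- serves.
  · refine ⟨fun _ => z 0, by rintro _ ⟨k, rfl⟩; exact ⟨0, rfl⟩, ?_, ?_⟩
    · simpa [closedLength] using closedLength_nonneg z
    · have h0 := (convex_convexHull ℝ (Set.range z)).addHaar_frontier volume
      have hcl : IsClosed (convexHull ℝ (Set.range z)) :=
        ((Set.finite_range z).isCompact_convexHull ℝ).isClosed
      rw [hcl.frontier_eq, hempty, Set.sdiff_empty] at h0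
      rw [h0]
      simp [signedArea, cross_self]
  obtain ⟨l, hlen, hrange, hsum⟩ := sum_eq_cycleSum z
  obtain ⟨l', h1, h2, h3, h4, h5⟩ := exists_isConvexTour l
  have hhull : convexHull ℝ {y | y ∈ l'} = convexHull ℝ (Set.range z) := by
    rw [← hrange]
    exact (convexHull_mono h1).antisymm (convexHull_min h4 (convex_convexHull ℝ _))
  rw [← hhull] at hc ⊢
  cases l' with
  | nil => simp at hc
  | cons a t =>
    -- Copies of the first vertex restore the count `m`; the degenerate edges add neither length nor
    -- area.
    obtain ⟨w, hw1, hw2⟩ := exists_ofFn_eq (m := m)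
      (List.replicate (m - (a :: t).length) a ++ a :: t) (by
        rw [hlen] at h2
        rw [List.length_append, List.length_replicate]
        omega)
    refine ⟨w, ?_, ?_, ?_⟩
    · rw [hw1, ← hrange]
      intro x hx
      rcases List.mem_append.1 hx with hx | hx
      · rw [List.eq_of_mem_replicate hx]
        exact h1 (by simp)
      · exact h1 hx
    · rw [closedLength, closedLength, hw2, hsum, cycleSum_replicate_append dist_self]
      exact h3
    · have h6 := signedArea_affine w 1 c
      simp only [Complex.ofReal_one, one_mul, one_pow] at h6
      rw [← h6, signedArea, Finset.sum_div,
        hw2 (fun p q => cross (p - c) (q - c) / 2),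
        cycleSum_replicate_append (fun a => by rw [cross_self, zero_div])]
      exact h5.volume_le hc

end

end

section

open MeasureTheory

/-! ### The isoperimetric inequality for the convex hull of a closed polygon -/

section Hull

variable {m : ℕ} [NeZero m]

open ZMod

theorem volume_convexHull_le (hm : 3 ≤ m) (z : ZMod m → ℂ) :
    4 * rho m * (volume (convexHull ℝ (Set.range z))).toReal ≤ closedLength z ^ 2 := by
  obtain ⟨w, -, h2, h3⟩ := exists_volume_convexHull_le z
  have hρ := rho_pos hm
  calc 4 * rho m * (volume (convexHull ℝ (Set.range z))).toReal
      ≤ 4 * rho m * signedArea w := mul_le_mul_of_nonneg_left h3 (by positivity)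
    _ ≤ closedLength w ^ 2 := signedArea_le hm w
    _ ≤ closedLength z ^ 2 := pow_le_pow_left₀ (closedLength_nonneg w) h2 2

theorem normSq_stdAddChar_sub_one (j : ZMod m) :
    Complex.normSq (stdAddChar j - 1) = 4 * Real.sin (Real.pi * j.val / m) ^ 2 := by
  rw [Complex.normSq_apply, Complex.sub_re, Complex.sub_im, (stdAddChar_re_im j).1,
    (stdAddChar_re_im j).2, Real.cos_two_mul, Real.sin_two_mul, Complex.one_re, Complex.one_im]
  have := Real.sin_sq_add_cos_sq (Real.pi * j.val / m)
  set s := Real.sin (Real.pi * j.val / m)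
  set c := Real.cos (Real.pi * j.val / m)
  have hs : s ^ 2 = 1 - c ^ 2 := by linarith
  ring_nf
  rw [hs]
  ring

theorem norm_stdAddChar_one_sub_one (hm : 3 ≤ m) :
    ‖(stdAddChar (1 : ZMod m) : ℂ) - 1‖ = 2 * Real.sin (Real.pi / m) := by
  have : Fact (1 < m) := ⟨by omega⟩
  have hs : 0 ≤ Real.sin (Real.pi / m) :=
    Real.sin_nonneg_of_nonneg_of_le_pi (pi_div_pos m).le
      (by linarith [pi_div_lt hm, Real.pi_pos])
  rw [← sq_eq_sq₀ (norm_nonneg _) (by positivity), ← Complex.normSq_eq_norm_sq,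
    normSq_stdAddChar_sub_one, ZMod.val_one, Nat.cast_one, mul_one]
  ring

/-- The sides are the shortest chords of a regular polygon: the squares differ by
$4\sin(\pi(j+1)/m)\sin(\pi(j-1)/m)$, whose factors are nonnegative for $1\le j\le m-1$ and vanish
only at $j=m-1$ and $j=1$. -/
theorem norm_stdAddChar_one_sub_one_le (hm : 3 ≤ m) {j : ZMod m} (hj : j ≠ 0) :
    ‖(stdAddChar (1 : ZMod m) : ℂ) - 1‖ ≤ ‖(stdAddChar j : ℂ) - 1‖ ∧
      (‖(stdAddChar (1 : ZMod m) : ℂ) - 1‖ = ‖(stdAddChar j : ℂ) - 1‖ → j = 1 ∨ j = -1) := by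
  have : Fact (1 < m) := ⟨by omega⟩
  have hmpos : (0 : ℝ) < m := by exact_mod_cast (by omega : 0 < m)
  have hpi := Real.pi_pos
  have key : ‖(stdAddChar j : ℂ) - 1‖ ^ 2 - ‖(stdAddChar (1 : ZMod m) : ℂ) - 1‖ ^ 2 =
      4 * (Real.sin (Real.pi * (j.val + 1) / m) * Real.sin (Real.pi * (j.val - 1) / m)) := by
    rw [← Complex.normSq_eq_norm_sq, ← Complex.normSq_eq_norm_sq, normSq_stdAddChar_sub_one,
      normSq_stdAddChar_sub_one, ZMod.val_one, Nat.cast_one,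
      show Real.pi * ((j.val : ℝ) + 1) / m = Real.pi * j.val / m + Real.pi * 1 / m by ring,
      show Real.pi * ((j.val : ℝ) - 1) / m = Real.pi * j.val / m - Real.pi * 1 / m by ring,
      Real.sin_add, Real.sin_sub]
    have h1 := Real.sin_sq_add_cos_sq (Real.pi * j.val / m)
    have h2 := Real.sin_sq_add_cos_sq (Real.pi * 1 / m)
    linear_combination (4 * Real.sin (Real.pi * 1 / m) ^ 2) * h1 -
      (4 * Real.sin (Real.pi * j.val / m) ^ 2) * h2
  have hv0 : j.val ≠ 0 := by rwa [Ne, ZMod.val_eq_zero]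
  have hv1 : (1 : ℝ) ≤ j.val := by exact_mod_cast Nat.one_le_iff_ne_zero.2 hv0
  have hv2 : (j.val : ℝ) + 1 ≤ m := by exact_mod_cast ZMod.val_lt j
  have s1 : 0 ≤ Real.sin (Real.pi * (j.val + 1) / m) :=
    Real.sin_nonneg_of_nonneg_of_le_pi (by positivity)
      (by rw [div_le_iff₀ hmpos]; exact mul_le_mul_of_nonneg_left hv2 hpi.le)
  have s2 : 0 ≤ Real.sin (Real.pi * (j.val - 1) / m) :=
    Real.sin_nonneg_of_nonneg_of_le_pi
      (div_nonneg (mul_nonneg hpi.le (by linarith)) hmpos.le)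
      (by rw [div_le_iff₀ hmpos]; exact mul_le_mul_of_nonneg_left (by linarith) hpi.le)
  refine ⟨?_, fun heq => ?_⟩
  · refine (pow_le_pow_iff_left₀ (norm_nonneg _) (norm_nonneg _) two_ne_zero).1 ?_
    have := mul_nonneg s1 s2
    linarith
  · rw [heq, sub_self, eq_comm, mul_eq_zero, or_iff_right (by norm_num), mul_eq_zero] at key
    rcases key with key | key
    · right
      by_contra hne
      have hv3 : (j.val : ℝ) + 1 ≠ m := fun h => hne <| by
        have h' : ((j.val + 1 : ℕ) : ZMod m) = (m : ℕ) := congrArg _ (by exact_mod_cast h)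
        rw [Nat.cast_succ, ZMod.natCast_zmod_val, ZMod.natCast_self] at h'
        exact eq_neg_of_add_eq_zero_left h'
      refine (Real.sin_pos_of_pos_of_lt_pi (by positivity) ?_).ne' key
      rw [div_lt_iff₀ hmpos]
      exact mul_lt_mul_of_pos_left (lt_of_le_of_ne hv2 hv3) hpi
    · left
      by_contra hne
      have hv3 : (1 : ℝ) ≠ j.val := fun h => hne <| by
        have h' : j.val = 1 := by exact_mod_cast h.symm
        rw [← ZMod.natCast_zmod_val j, h', Nat.cast_one]
      have hv4 : (0 : ℝ) < j.val - 1 := sub_pos.2 (lt_of_le_of_ne hv1 hv3)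
      refine (Real.sin_pos_of_pos_of_lt_pi (by positivity) ?_).ne' key
      rw [div_lt_iff₀ hmpos]
      exact mul_lt_mul_of_pos_left (by linarith) hpi

theorem dist_regular (c b : ℂ) (i j : ZMod m) :
    dist (c + b * stdAddChar i) (c + b * stdAddChar j) = ‖b‖ * ‖(stdAddChar (j - i) : ℂ) - 1‖ := by
  have h1 : ‖(stdAddChar i : ℂ)‖ = 1 := AddChar.norm_apply _ _
  rw [dist_comm, dist_eq_norm,
    show c + b * stdAddChar j - (c + b * stdAddChar i) =
      b * (stdAddChar i * (stdAddChar (j - i) - 1)) by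
        rw [mul_sub (stdAddChar i : ℂ), ← AddChar.map_add_eq_mul, add_sub_cancel]; ring,
    norm_mul, norm_mul, h1, one_mul]

theorem closedLength_regular (hm : 3 ≤ m) (c b : ℂ) :
    closedLength (fun k : ZMod m => c + b * stdAddChar k) =
      m * (‖b‖ * (2 * Real.sin (Real.pi / m))) := by
  simp only [closedLength, dist_regular, add_sub_cancel_left, norm_stdAddChar_one_sub_one hm,
    Finset.sum_const, Finset.card_univ, ZMod.card, nsmul_eq_mul]

/-- The points on a closed polygon. -/
def curve {m : ℕ} (z : ZMod m → ℂ) : Set ℂ := ⋃ k, segment ℝ (z k) (z (k + 1))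

/-- An injective walk with steps `±1` cannot turn back, since that would revisit a point after two
steps and `2 ≠ 0`. -/
theorem eq_add_mul_of_step (hm : 3 ≤ m) {σ : ZMod m → ZMod m} (hσ : Function.Injective σ)
    (h : ∀ k, σ (k + 1) - σ k = 1 ∨ σ (k + 1) - σ k = -1) :
    (∀ k, σ (k + 1) = σ k + 1) ∨ (∀ k, σ (k + 1) = σ k - 1) := by
  have h2 : (2 : ZMod m) ≠ 0 := by
    have : ((2 : ℕ) : ZMod m) ≠ 0 := by
      rw [Ne, ZMod.natCast_eq_zero_iff]
      exact fun h => absurd (Nat.le_of_dvd (by norm_num) h) (by omega)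
    exact_mod_cast this
  have hstep : ∀ k, σ (k + 1 + 1) - σ (k + 1) = σ (k + 1) - σ k := by
    intro k
    have hne : σ (k + 1 + 1) ≠ σ k := fun h => h2 <| by
      have := hσ h
      linear_combination this
    rcases h k with h1 | h1 <;> rcases h (k + 1) with h3 | h3
    · rw [h1, h3]
    · exact absurd (by linear_combination h1 + h3) hne
    · exact absurd (by linear_combination h1 + h3) hne
    · rw [h1, h3]
  have hall : ∀ k, σ (k + 1) - σ k = σ (0 + 1) - σ 0 := by
    have : ∀ n : ℕ, σ ((n : ZMod m) + 1) - σ n = σ (0 + 1) - σ 0 := by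
      intro n
      induction n with
      | zero => rw [Nat.cast_zero]
      | succ n ih => rw [← ih, Nat.cast_succ, hstep]
    intro k
    have := this k.val
    rwa [ZMod.natCast_zmod_val] at this
  rcases h 0 with h0 | h0
  · left; intro k; linear_combination hall k + h0
  · right; intro k; linear_combination hall k + h0

theorem curve_comp_equiv {m : ℕ} {w : ZMod m → ℂ} (σ : ZMod m ≃ ZMod m)
    (h : (∀ k, σ (k + 1) = σ k + 1) ∨ (∀ k, σ (k + 1) = σ k - 1)) :
    curve (fun k => w (σ k)) = curve w := by
  unfold curve
  rcases h with h | h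
  · simp only [h]
    exact σ.iSup_comp (g := fun j => segment ℝ (w j) (w (j + 1)))
  · simp only [h]
    refine (σ.iSup_comp (g := fun j => segment ℝ (w j) (w (j - 1)))).trans
      (((Equiv.addRight (1 : ZMod m)).iSup_comp
        (g := fun j => segment ℝ (w j) (w (j - 1)))).symm.trans (iSup_congr fun j => ?_))
    rw [Equiv.coe_addRight, add_sub_cancel_right, segment_symm]

/-- Equality in the isoperimetric inequality for the convex hull holds only for polygons that run
along a regular polygon. -/
theorem exists_regular_of_volume_eq (hm : 3 ≤ m) {z : ZMod m → ℂ} (hz : Function.Injective z)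
    (h : 4 * rho m * (volume (convexHull ℝ (Set.range z))).toReal = closedLength z ^ 2) :
    ∃ c b : ℂ, curve z = curve (fun k : ZMod m => c + b * stdAddChar k) ∧
      closedLength z = m * (‖b‖ * (2 * Real.sin (Real.pi / m))) := by
  obtain ⟨w, h1, h2, h3⟩ := exists_volume_convexHull_le z
  have hρ := rho_pos hm
  have e1 : 4 * rho m * (volume (convexHull ℝ (Set.range z))).toReal ≤ 4 * rho m * signedArea w :=
    mul_le_mul_of_nonneg_left h3 (by positivity)
  have e2 := signedArea_le hm w
  have e3 : closedLength w ^ 2 ≤ closedLength z ^ 2 :=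
    pow_le_pow_left₀ (closedLength_nonneg w) h2 2
  have hlen : closedLength z = closedLength w := by
    rw [← sq_eq_sq₀ (closedLength_nonneg z) (closedLength_nonneg w)]
    linarith
  obtain ⟨c, b, hw⟩ := exists_regular_of_signedArea_eq hm (v := w) (by linarith)
  have hw' : w = fun k : ZMod m => c + b * stdAddChar k := funext hw
  have hPw := closedLength_regular (m := m) hm c b
  rw [← hw', ← hlen] at hPw
  refine ⟨c, b, ?_, hPw⟩
  have : Fact (1 < m) := ⟨by omega⟩
  have hb : b ≠ 0 := by
    rintro rfl
    rw [norm_zero, zero_mul, mul_zero] at hPw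
    have h0 := dist_le_closedLength z 0
    rw [hPw, dist_le_zero] at h0
    exact zero_ne_one ((hz h0).trans (zero_add 1))
  have hinj : Function.Injective w := by
    intro i j hij
    rw [hw, hw] at hij
    exact injective_stdAddChar (mul_left_cancel₀ hb (add_left_cancel hij))
  -- The distinct vertices of `w` are among the `m` values of `z`, so by counting `z` is a
  -- reordering of `w`.
  choose τ hτ using fun k => h1 (Set.mem_range_self k)
  have hτinj : Function.Injective τ := fun i j hij => hinj (by rw [← hτ i, ← hτ j, hij])
  let σ : ZMod m ≃ ZMod m := (Equiv.ofBijective τ (Finite.injective_iff_bijective.1 hτinj)).symm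
  have hzσ : ∀ k, z k = w (σ k) := fun k => by
    rw [← hτ]
    congr 1
    exact ((Equiv.ofBijective τ (Finite.injective_iff_bijective.1 hτinj)).apply_symm_apply k).symm
  have hne : ∀ k, σ (k + 1) - σ k ≠ 0 := fun k h0 => by
    have := σ.injective (sub_eq_zero.1 h0)
    simp at this
  have hdist : ∀ k, dist (z k) (z (k + 1)) = ‖b‖ * ‖(stdAddChar (σ (k + 1) - σ k) : ℂ) - 1‖ := by
    intro k
    rw [hzσ, hzσ, hw, hw, dist_regular]
  have hle : ∀ k ∈ Finset.univ, ‖b‖ * ‖(stdAddChar (1 : ZMod m) : ℂ) - 1‖ ≤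
      ‖b‖ * ‖(stdAddChar (σ (k + 1) - σ k) : ℂ) - 1‖ := fun k _ =>
    mul_le_mul_of_nonneg_left (norm_stdAddChar_one_sub_one_le hm (hne k)).1 (norm_nonneg b)
  have hsum : ∑ k : ZMod m, ‖b‖ * ‖(stdAddChar (1 : ZMod m) : ℂ) - 1‖ =
      ∑ k, ‖b‖ * ‖(stdAddChar (σ (k + 1) - σ k) : ℂ) - 1‖ := by
    simp only [← hdist]
    change _ = closedLength z
    rw [hPw, norm_stdAddChar_one_sub_one hm, Finset.sum_const, Finset.card_univ, ZMod.card,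
      nsmul_eq_mul]
  -- No edge of `z` is shorter than a side and the totals agree, so every edge has the length of a
  -- side.
  have heq := (Finset.sum_eq_sum_iff_of_le hle).1 hsum
  have hstep : ∀ k, σ (k + 1) - σ k = 1 ∨ σ (k + 1) - σ k = -1 := fun k =>
    (norm_stdAddChar_one_sub_one_le hm (hne k)).2
      (mul_left_cancel₀ (norm_ne_zero_iff.2 hb) (heq k (Finset.mem_univ k)))
  rw [show z = fun k => w (σ k) from funext hzσ, curve_comp_equiv σ
    (eq_add_mul_of_step hm σ.injective hstep), hw']

end Hull

end

section

open MeasureTheory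

/-! ### Transfer to the Euclidean plane -/

/-- The enclosed region of a curve lies in every closed convex set that contains the curve. -/
theorem enclosedRegion_subset {C K : Set Plane} (hC : C.Nonempty) (hCK : C ⊆ K) (hK : Convex ℝ K)
    (hK' : IsClosed K) : enclosedRegion C ⊆ K := by
  rintro x (hx | ⟨-, hbdd⟩)
  · exact hCK hx
  by_contra hxK
  obtain ⟨f, u, hf, hu⟩ := geometric_hahn_banach_closed_point hK hK' hxK
  obtain ⟨a, ha⟩ := hC
  have hv : 0 < f (x - a) := by
    rw [map_sub]
    linarith [hf a (hCK ha)]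
  have hv0 : 0 < ‖x - a‖ := norm_pos_iff.2 fun h0 => by rw [h0, map_zero] at hv; exact hv.false
  -- The separating functional grows along this ray, which therefore misses `K` and puts an
  -- unbounded set into the component of `x`.
  set R : Set Plane := (fun t : ℝ => x + t • (x - a)) '' Set.Ici 0 with hR
  have hRc : IsPreconnected R :=
    isPreconnected_Ici.image _ (by fun_prop)
  have hRC : R ⊆ Cᶜ := by
    rintro _ ⟨t, ht, rfl⟩ hmem
    have h1 := hf _ (hCK hmem)
    have h2 := mul_nonneg (Set.mem_Ici.1 ht) hv.le
    rw [map_add, map_smul, smul_eq_mul] at h1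
    linarith
  have hxR : x ∈ R := ⟨0, Set.self_mem_Ici, by simp⟩
  obtain ⟨r, hr⟩ := (hbdd.subset (hRc.subset_connectedComponentIn hxR hRC)).subset_closedBall x
  set t : ℝ := (|r| + 1) / ‖x - a‖ with ht
  have hmem := hr ⟨t, Set.mem_Ici.2 (by positivity), rfl⟩
  rw [Metric.mem_closedBall, dist_self_add_left, norm_smul, Real.norm_of_nonneg (by positivity),
    ht, div_mul_cancel₀ _ hv0.ne'] at hmem
  linarith [le_abs_self r]

/-- The identification of the Euclidean plane with the complex numbers. -/
def toComplex : Plane ≃ₗᵢ[ℝ] ℂ := Complex.orthonormalBasisOneI.repr.symm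

theorem toComplex_re (x : Plane) : (toComplex x).re = x 0 := by simp [toComplex]

theorem toComplex_im (x : Plane) : (toComplex x).im = x 1 := by simp [toComplex]

/-- Both volumes are the two-dimensional Hausdorff measure, which isometries preserve. -/
theorem volume_image_toComplex (s : Set Plane) : volume (toComplex '' s) = volume s := by
  have hC : (μHE[2] : Measure ℂ) = volume := by
    rw [← InnerProductSpace.euclideanHausdorffMeasure_eq_volume, Complex.finrank_real_complex]
  have h := toComplex.isometry.euclideanHausdorffMeasure_image (d := 2) s
  rwa [EuclideanSpace.euclideanHausdorffMeasure_eq_volume, hC] at h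

theorem volume_image_affineIsometryEquiv (f : Plane ≃ᵃⁱ[ℝ] Plane) (s : Set Plane) :
    volume (f '' s) = volume s := by
  have h := f.isometry.euclideanHausdorffMeasure_image (d := 2) s
  rwa [EuclideanSpace.euclideanHausdorffMeasure_eq_volume] at h

section Polygon

variable {n : ℕ}

/-- The vertices of a polygon as complex numbers. -/
def complexVertices (M : Polygon Plane (n + 1)) : ZMod (n + 1) → ℂ :=
  fun k => toComplex (M.vertices k)

theorem perimeter_eq_closedLength (M : Polygon Plane (n + 1)) :
    perimeter M = closedLength (complexVertices M) := by
  refine Finset.sum_congr rfl fun i _ => ?_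
  rw [finRotate_apply]
  exact (toComplex.dist_map _ _).symm

theorem image_boundary (M : Polygon Plane (n + 1)) :
    toComplex '' M.boundary ℝ = curve (complexVertices M) := by
  unfold Polygon.boundary
  rw [Set.image_iUnion]
  refine Set.iUnion_congr fun i => ?_
  rw [Polygon.edgeSet, affineSegment_eq_segment, finRotate_apply]
  exact image_segment ℝ (toComplex.toLinearEquiv.toLinearMap.toAffineMap) _ _

theorem boundary_subset_convexHull (M : Polygon Plane (n + 1)) :
    M.boundary ℝ ⊆ convexHull ℝ (Set.range M.vertices) := by
  refine Set.iUnion_subset fun i => ?_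
  rw [Polygon.edgeSet, affineSegment_eq_segment]
  exact segment_subset_convexHull (Set.mem_range_self _) (Set.mem_range_self _)

theorem mem_boundary (M : Polygon Plane (n + 1)) (i : Fin (n + 1)) : M.vertices i ∈ M.boundary ℝ :=
  Set.mem_iUnion.2 ⟨i, left_mem_affineSegment ℝ _ _⟩

theorem volume_convexHull_vertices (M : Polygon Plane (n + 1)) :
    volume.real (convexHull ℝ (Set.range M.vertices)) =
      (volume (convexHull ℝ (Set.range (complexVertices M)))).toReal := by
  have h : convexHull ℝ (Set.range (complexVertices M)) =
      toComplex '' convexHull ℝ (Set.range M.vertices) := by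
    have := AffineMap.image_convexHull toComplex.toLinearEquiv.toLinearMap.toAffineMap
      (Set.range M.vertices)
    rw [← Set.range_comp] at this
    exact this.symm
  rw [h, volume_image_toComplex]
  rfl

theorem isCompact_convexHull_vertices (M : Polygon Plane (n + 1)) :
    IsCompact (convexHull ℝ (Set.range M.vertices)) :=
  (Set.finite_range _).isCompact_convexHull ℝ

/-- The isometry allows two uses: the identity for the inequality, and a congruence with the regular
polygon for the converse of the equality case. -/
theorem area_le_volume_convexHull {C : Set Plane} {M : Polygon Plane (n + 1)}
    (f : Plane ≃ᵃⁱ[ℝ] Plane) (hC : C.Nonempty)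
    (hCM : f '' C ⊆ convexHull ℝ (Set.range M.vertices)) :
    area C ≤ volume.real (convexHull ℝ (Set.range M.vertices)) := by
  set K := convexHull ℝ (Set.range M.vertices) with hK
  have hsub : enclosedRegion C ⊆ f ⁻¹' K :=
    enclosedRegion_subset hC (Set.image_subset_iff.1 hCM)
      ((convex_convexHull ℝ _).affine_preimage f.toAffineEquiv.toAffineMap)
      ((isCompact_convexHull_vertices M).isClosed.preimage f.continuous)
  have hvol : volume (f ⁻¹' K) = volume K := by
    rw [← volume_image_affineIsometryEquiv f, Set.image_preimage_eq _ f.surjective]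
  rw [area, measureReal_def, measureReal_def, ← hvol]
  refine ENNReal.toReal_mono ?_ (measure_mono hsub)
  rw [hvol]
  exact (isCompact_convexHull_vertices M).measure_lt_top.ne

theorem rho_mul_polyArea_le (hn : 3 ≤ n + 1) (M : Polygon Plane (n + 1)) :
    polyArea M ≤ volume.real (convexHull ℝ (Set.range M.vertices)) ∧
      4 * rho (n + 1) * volume.real (convexHull ℝ (Set.range M.vertices)) ≤ perimeter M ^ 2 := by
  refine ⟨area_le_volume_convexHull (AffineIsometryEquiv.refl ℝ Plane) ⟨_, mem_boundary M 0⟩ ?_, ?_⟩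
  · simpa using boundary_subset_convexHull M
  · rw [volume_convexHull_vertices, perimeter_eq_closedLength]
    exact volume_convexHull_le hn _

theorem vertices_injective {M : Polygon Plane (n + 1)} (hM : IsSimple M) :
    Function.Injective M.vertices := by
  intro i j hij
  refine (hM i j 0 (by simp) 0 (by simp) ?_).1
  simpa [Polygon.edgePath] using hij

theorem perimeter_pos (hn : 3 ≤ n + 1) {M : Polygon Plane (n + 1)} (hM : IsSimple M) :
    0 < perimeter M := by
  refine Finset.sum_pos (fun i _ => dist_pos.2 fun h => ?_) ⟨0, Finset.mem_univ _⟩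
  have h1 := vertices_injective hM h
  rw [finRotate_apply] at h1
  have : NeZero n := ⟨by omega⟩
  simp at h1

theorem fundamentalMeasure_eq (hn : 3 ≤ n + 1) {M : Polygon Plane (n + 1)} (hM : IsSimple M)
    (hU : IsUnitPolygon M) : fundamentalMeasure M = polyArea M := by
  have hpos : 0 < semiperimeter M := half_pos (perimeter_pos hn hM)
  -- Positivity of the perimeter excludes `0 / 0`, which would be 0 rather than 1.
  have h1 : semiperimeter M / polyArea M = 1 := by rw [hU, div_self hpos.ne']
  rw [fundamentalMeasure, canonicalUnit, h1]
  simp [scale]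

theorem complexVertices_regularPolygon (k : ZMod (n + 1)) :
    complexVertices (regularPolygon (n + 1)) k =
      0 + ((1 / Real.cos (Real.pi / (n + 1 : ℕ)) : ℝ) : ℂ) * ZMod.stdAddChar k := by
  have h1 := stdAddChar_re_im k
  have hk : (k.val : ℕ) = Fin.val (n := n + 1) k := rfl
  rw [zero_add, complexVertices]
  apply Complex.ext
  · rw [Complex.re_ofReal_mul, h1.1, toComplex_re, hk]
    simp only [regularPolygon, PiLp.smul_apply, smul_eq_mul, Matrix.cons_val_zero]
    congr 2
    ring
  · rw [Complex.im_ofReal_mul, h1.2, toComplex_im, hk]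
    simp only [regularPolygon, PiLp.smul_apply, smul_eq_mul, Matrix.cons_val_one,
      Matrix.cons_val_zero]
    congr 2
    ring

theorem perimeter_regularPolygon (hn : 3 ≤ n + 1) :
    perimeter (regularPolygon (n + 1)) = 2 * rho (n + 1) := by
  have hc := cos_pi_div_pos hn
  rw [perimeter_eq_closedLength, funext complexVertices_regularPolygon, closedLength_regular hn,
    Complex.norm_real, Real.norm_of_nonneg (by positivity), rho, Real.tan_eq_sin_div_cos]
  ring

theorem areCongruent_of_curve_eq {M N : Polygon Plane (n + 1)} {c b : ℂ} {r : ℝ} (hr : 0 < r)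
    (hb : ‖b‖ = r)
    (hM : curve (complexVertices M) = curve (fun k : ZMod (n + 1) => c + b * ZMod.stdAddChar k))
    (hN : ∀ k, complexVertices N k = 0 + (r : ℂ) * ZMod.stdAddChar k) :
    AreCongruent (M.boundary ℝ) (N.boundary ℝ) := by
  have hrC : (r : ℂ) ≠ 0 := by exact_mod_cast hr.ne'
  let u : Circle := ⟨b / r, by
    rw [Submonoid.unitSphere, Submonoid.mem_mk, Subsemigroup.mem_mk, mem_sphere_zero_iff_norm,
      norm_div, hb, Complex.norm_real, Real.norm_of_nonneg hr.le,
      div_self hr.ne']⟩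
  let g : ℂ ≃ᵃⁱ[ℝ] ℂ :=
    (rotation u).toAffineIsometryEquiv.trans (AffineIsometryEquiv.constVAdd ℝ ℂ c)
  have hg : ∀ x, g x = c + b / r * x := fun x => rfl
  have himg : g '' curve (complexVertices N) = curve (complexVertices M) := by
    rw [hM, curve, Set.image_iUnion]
    refine Set.iUnion_congr fun k => ?_
    have h1 := image_segment ℝ g.toAffineEquiv.toAffineMap (complexVertices N k)
      (complexVertices N (k + 1))
    have h2 : ∀ j, g (complexVertices N j) = c + b * ZMod.stdAddChar j := fun j => by
      rw [hg, hN]; field_simp; ring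
    exact h1.trans (congrArg₂ (segment ℝ) (h2 k) (h2 (k + 1)))
  refine ⟨toComplex.toAffineIsometryEquiv.trans
    (g.symm.trans toComplex.symm.toAffineIsometryEquiv), ?_⟩
  have hcomp : ∀ x, (toComplex.toAffineIsometryEquiv.trans
    (g.symm.trans toComplex.symm.toAffineIsometryEquiv)) x =
      toComplex.symm (g.symm (toComplex x)) := fun x => rfl
  calc _ = toComplex.symm '' (g.symm '' (toComplex '' M.boundary ℝ)) := by
        rw [Set.image_image, Set.image_image]
        exact Set.image_congr fun x _ => hcomp x
    _ = N.boundary ℝ := by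
        rw [image_boundary, ← himg, ← image_boundary, Set.image_image g.symm, Set.image_image,
          Set.image_image]
        simp

end Polygon

end

end UnitShapes

end

/-! ### The bound for unit polygons and its equality case -/

theorem corollary5p4 (m : ℕ) (hm : 3 ≤ m) (M : Polygon UnitShapes.Plane m)
    (hM : UnitShapes.IsSimple M) (hU : UnitShapes.IsUnitPolygon M) :
    UnitShapes.rho m ≤ UnitShapes.fundamentalMeasure M ∧
      (UnitShapes.rho m = UnitShapes.fundamentalMeasure M ↔
        UnitShapes.AreCongruent (M.boundary ℝ) ((UnitShapes.regularPolygon m).boundary ℝ)) := by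
  obtain ⟨n, rfl⟩ : ∃ n, m = n + 1 := Nat.exists_eq_succ_of_ne_zero (by omega)
  rw [UnitShapes.fundamentalMeasure_eq hm hM hU]
  have hρ := UnitShapes.rho_pos hm
  have hpos := UnitShapes.perimeter_pos hm hM
  have hA : UnitShapes.perimeter M = 2 * UnitShapes.polyArea M := by
    rw [hU, UnitShapes.semiperimeter]; ring
  obtain ⟨h1, h2⟩ := UnitShapes.rho_mul_polyArea_le hm M
  have hApos : 0 < UnitShapes.polyArea M := by linarith
  have hle : UnitShapes.rho (n + 1) ≤ UnitShapes.polyArea M := by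
    have h3 := (mul_le_mul_of_nonneg_left h1
      (by positivity : 0 ≤ 4 * UnitShapes.rho (n + 1))).trans h2
    rw [hA] at h3
    exact le_of_mul_le_mul_right (by linarith) hApos
  refine ⟨hle, fun heq => ?_, fun hcong => le_antisymm hle ?_⟩
  · have hc := UnitShapes.cos_pi_div_pos hm
    have hinj : Function.Injective (UnitShapes.complexVertices M) :=
      UnitShapes.toComplex.injective.comp (UnitShapes.vertices_injective hM)
    have hvol : 4 * UnitShapes.rho (n + 1) * (MeasureTheory.volume (convexHull ℝ
        (Set.range (UnitShapes.complexVertices M)))).toReal =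
        UnitShapes.closedLength (UnitShapes.complexVertices M) ^ 2 := by
      -- With area `rho` and perimeter `2 * rho`, the hull is squeezed: its area is at least `rho`
      -- by inclusion and at most `rho` by the isoperimetric inequality.
      rw [← UnitShapes.volume_convexHull_vertices, ← UnitShapes.perimeter_eq_closedLength]
      refine le_antisymm h2 ?_
      rw [hA, ← heq]
      rw [← heq] at h1
      nlinarith
    obtain ⟨c, b, hcurve, hlen⟩ := UnitShapes.exists_regular_of_volume_eq hm hinj hvol
    refine UnitShapes.areCongruent_of_curve_eq (by positivity) ?_ hcurve
      UnitShapes.complexVertices_regularPolygon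
    -- Comparing the two expressions for the perimeter gives circumradius `1 / cos (π / m)`.
    rw [← UnitShapes.perimeter_eq_closedLength, hA, ← heq, UnitShapes.rho,
      Real.tan_eq_sin_div_cos] at hlen
    have hs : 0 < Real.sin (Real.pi / (n + 1 : ℕ)) :=
      Real.sin_pos_of_pos_of_lt_pi (UnitShapes.pi_div_pos _)
        (by linarith [UnitShapes.pi_div_lt hm, Real.pi_pos])
    have hm0 : (0 : ℝ) < (n + 1 : ℕ) := by positivity
    rw [eq_div_iff hc.ne']
    field_simp at hlen
    linarith
  -- Only an upper bound is needed: the area is at most that of the hull of the regular polygon,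
  -- which the isoperimetric inequality bounds by `(2 * rho) ^ 2 / (4 * rho)`.
  · obtain ⟨f, hf⟩ := hcong
    have h3 : UnitShapes.polyArea M ≤ _ := UnitShapes.area_le_volume_convexHull f
      (M := UnitShapes.regularPolygon (n + 1)) ⟨_, UnitShapes.mem_boundary M 0⟩
      (hf.trans_subset (UnitShapes.boundary_subset_convexHull _))
    have h4 := (UnitShapes.rho_mul_polyArea_le hm (UnitShapes.regularPolygon (n + 1))).2
    rw [UnitShapes.perimeter_regularPolygon hm] at h4
    refine h3.trans (le_of_mul_le_mul_left ?_ (by positivity : 0 < 4 * UnitShapes.rho (n + 1)))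
    linarith
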